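/- Let $p$ be a prime, let $\mathbb Z_p=\{a/b : a,b\in\mathbb Z,\ p\nmid b\}$ be the localization of $\mathbb Z$ at $p$, and for a nonzero integer $a$ let $[a]$ be the largest $r$ with $p^r\mid a$. Let $0,\alpha,\beta$ be distinct integers with $A:=[\alpha]=[\beta]\le D:=[\beta-\alpha]$, and let $R=\mathbb Z_p[x]/x(x-\alpha)(x-\beta)\mathbb Z_p[x]$. An ideal $I$ of $R$ is full if every element of $R$ has a nonzero integer multiple in $I$. Put $\zeta_R(s)=\sum_I|R:I|^{-s}$, summed over the full ideals; with $X=p^{-s}$ it is also regarded as the formal power series whose coefficient of $X^n$ is the number of full ideals of index $p^n$. For $r_1,r_2,r_3\in\mathbb N=\{0,1,2,\dots\}$ let $$S(r_2,r_3)=\{a\in\mathbb Z_p : p^{r_2}+a(\beta-\alpha)\in p^{r_3}\mathbb Z_p\},$$ and for $a\in S(r_2,r_3)$ let $S(r_1,r_2,r_3,a)$ be the set of $(a_1,a_2)\in\mathbb Z_p^2$ with $$p^{r_1}+\alpha a_1\in p^{r_2}\mathbb Z_p,\qquad (p^{r_2}-\alpha a)a_1+\beta p^{r_2}a_2-p^{r_1}a\in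 p^{r_2+r_3}\mathbb Z_p .$$ Let $\bar S(r_2,r_3)$ be the set of cosets of $p^{r_3}\mathbb Z_p$ contained in $S(r_2,r_3)$, let $\bar S(r_1,r_2,r_3,a)$ be the set of cosets of $\mathbb Z_p(p^{r_2},a)+\mathbb Z_p(0,p^{r_3})$ contained in $S(r_1,r_2,r_3,a)$, and put $$e(r_1,r_2,r_3)=\sum_{\bar a\in\bar S(r_2,r_3)}|\bar S(r_1,r_2,r_3,a)|,\qquad E(r_2,r_3)=\sum_{r_1\ge0}e(r_1,r_2,r_3)X^{r_1}\in\mathbb Z[[X]].$$ Let \begin{align*} R_1&=\{(r_3,r_2)\in\mathbb N^2 : D+A\le r_2,\ D+A\le r_3\},\\ R_2&=\{(r_3,r_2)\in\mathbb N^2 : D\le r_3,\ D\le r_2<\min\{D+A,r_3\}\},\\ R_3&=\{(r_3,r_2)\in\mathbb N^2 : A\le r_3<D+A,\ r_3+A\le r_2\},\\ R_4&=\{(r_3,r_2)\in\mathbb N^2 : r_3<A,\ A+r_3\le r_2\},\\ R_5&=\{(r_3,r_2)\in\mathbb N^2 : r_3\le r_2<A\},\\ R_6&=\{(r_3,r_2)\in\mathbb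 N^2 : r_3<D+A,\ \max\{A,r_3\}\le r_2<A+r_3\}. \end{align*} Theorem. Every full ideal of $R$ has index a power of $p$, and for each $n$ there are only finitely many of index $p^n$. Moreover the following hold. (a) In $\mathbb Z[[X]]$ (coefficientwise convergence, each inner sum being summable), $$\zeta_R=\sum_{i=1}^6\ \sum_{(r_3,r_2)\in R_i}X^{r_2+r_3}E(r_2,r_3).$$ (b) $E(r_2,r_3)=0$ if $r_2<\min\{D,r_3\}$. Writing $T_l=\sum_{r\ge l}X^r$, $m=\max\{0,r_3-D\}$ and $c_k=p^k-\lfloor p^{k-1}\rfloor$, on the six regions $E(r_2,r_3)$ equals, respectively, \begin{align*} R_1:&\quad p^{2A+D}T_{2A}; \qquad R_2:\quad p^{r_2+A}T_{r_2-D+A};\\ R_3:&\quad \sum_{m\le i<A}p^{A+i}c_{r_3-i}T_{A+i}+p^{A+r_3}T_{2A};\\ R_4:&\quad \sum_{0\le i\le r_3}p^{A+i}c_{r_3-i}T_{A+i}; \qquad R_5:\quad p^{r_2+r_3}T_{r_2};\\ R_6:&\quad \sum_{m\le i<r_2-A}p^{l_i}c_{r_3-i}T_{l_i}+\sum_{0\le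 j\le N}p^{m_j}\bigl(p^{N-j}-\varepsilon_j\lfloor p^{N-j-1}\rfloor\bigr)T_{m_j}+p^{n}p^{N-1}T_n, \end{align*} where $N=r_3-r_2+A$, $\varepsilon_0=2$, $\varepsilon_j=1$ for $j\ge1$, $l_i=\min\{A+i,2A,r_3+A\}$, $m_j=\min\{r_2+j,2A,r_3+A\}$ and $n=\min\{r_2,2A,r_3+A\}$. (c) For each $i$, $(1-X)^3\sum_{(r_3,r_2)\in R_i}X^{r_2+r_3}E(r_2,r_3)=N_i(X)$, where \begin{align*} N_1&=p^{2A+D}X^{2(2A+D)},\\ N_2&=(1-X)\sum_{r_2=D}^{D+A-1}p^{r_2+A}X^{3r_2+1+A-D},\\ N_3&=(1-X)\sum_{r_3=A}^{D+A-1}X^{2r_3+A}\Bigl(\sum_{m\le i<A}p^{A+i}c_{r_3-i}X^{A+i}+p^{A+r_3}X^{2A}\Bigr),\\ N_4&=(1-X)\sum_{r_3=0}^{A-1}X^{2r_3+A}\sum_{i=0}^{r_3}p^{A+i}c_{r_3-i}X^{A+i},\\ N_5&=(1-X)^2\sum_{0\le r_3\le r_2<A}p^{r_2+r_3}X^{2r_2+r_3},\\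 N_6&=(1-X)^2\sum_{(r_3,r_2)\in R_6}X^{r_2+r_3}F(r_2,r_3), \end{align*} and $F(r_2,r_3)$ is the expression for $R_6$ in (b) with every $T_l$ replaced by $X^l$. Consequently $(1-X)^3\zeta_R=\sum_{i=1}^6N_i(X)$. (d) For every $s\in\mathbb C$ with $\operatorname{Re}s>0$, the series $\zeta_R(s)$ converges absolutely, and so does, for each $i$, the series over $(r_3,r_2)\in R_i$, $r_1\in\mathbb N$ in $$\zeta_R(s)=\sum_{i=1}^6\ \sum_{(r_3,r_2)\in R_i}\ \sum_{r_1\ge0}e(r_1,r_2,r_3)\,p^{-s(r_1+r_2+r_3)}=\frac{\sum_{i=1}^6N_i(p^{-s})}{(1-p^{-s})^3}.$$ -/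

import Mathlib

open scoped PowerSeries.WithPiTopology

/-- The ideal `pℤ` of `ℤ` is prime. -/
instance IdealZeta.span_isPrime (p : ℕ) [Fact p.Prime] :
    (Ideal.span {(p : ℤ)}).IsPrime :=
  (Ideal.span_singleton_prime (by exact_mod_cast (Fact.out : p.Prime).ne_zero)).mpr
    (Nat.prime_iff_prime_int.mp Fact.out)

namespace IdealZeta

noncomputable section

/-- `ℤ_p = {a / b | a, b ∈ ℤ, p ∤ b}`, the localization of `ℤ` at the prime `p`. -/
abbrev Zloc (p : ℕ) [Fact p.Prime] : Type :=
  Localization.AtPrime (Ideal.span {(p : ℤ)})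

/-- `R = ℤ_p[x] / x(x - α)(x - β)ℤ_p[x]`. -/
abbrev R (p : ℕ) [Fact p.Prime] (α β : ℤ) : Type :=
  AdjoinRoot (Polynomial.X * (Polynomial.X - Polynomial.C (α : Zloc p)) *
    (Polynomial.X - Polynomial.C (β : Zloc p)))

/-- An ideal is full if it spans `ℚ ⊗ A`, i.e. every element of the ring has a nonzero
integer multiple in it. -/
def IsFull {A : Type} [CommRing A] (I : Ideal A) : Prop :=
  ∀ f : A, ∃ n : ℕ, n ≠ 0 ∧ n • f ∈ I

/-- The index `|A : I|` (which is `0` by convention if it is infinite). -/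
def idx {A : Type} [CommRing A] (I : Ideal A) : ℕ := Nat.card (A ⧸ I)

/-- The local ideal zeta function `ζ_R(s) = ∑_I |R : I|^{-s}`, summed over the full ideals. -/
def zeta (p : ℕ) [Fact p.Prime] (α β : ℤ) (s : ℂ) : ℂ :=
  ∑' I : {I : Ideal (R p α β) // IsFull I}, (idx I.1 : ℂ) ^ (-s)

/-- `ζ_R` as a formal power series in `X = p^{-s}`: the coefficient of `X ^ n` is the number of
full ideals of index `p ^ n`. -/
def zetaSeries (p : ℕ) [Fact p.Prime] (α β : ℤ) : PowerSeries ℤ :=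
  PowerSeries.mk fun n =>
    (Nat.card {I : Ideal (R p α β) // IsFull I ∧ idx I = p ^ n} : ℤ)

/-! ### The operator `E(r₂, r₃)` -/

/-- `S(r₂, r₃)`: the `a₃ ∈ ℤ_p` with `p^{r₂} + a₃(β - α) ∈ p^{r₃}ℤ_p`. -/
def S (p : ℕ) [Fact p.Prime] (α β : ℤ) (r₂ r₃ : ℕ) : Set (Zloc p) :=
  {a₃ | (p : Zloc p) ^ r₃ ∣ (p : Zloc p) ^ r₂ + a₃ * ((β : Zloc p) - (α : Zloc p))}

/-- `S(r₁, r₂, r₃, a₃)`: the `(a₁, a₂) ∈ ℤ_p²` with `p^{r₁} + α a₁ ∈ p^{r₂}ℤ_p` and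
`(p^{r₂} - α a₃) a₁ + β p^{r₂} a₂ - p^{r₁} a₃ ∈ p^{r₂ + r₃}ℤ_p`. -/
def SS (p : ℕ) [Fact p.Prime] (α β : ℤ) (r₁ r₂ r₃ : ℕ) (a₃ : Zloc p) :
    Set (Zloc p × Zloc p) :=
  {a | (p : Zloc p) ^ r₂ ∣ (p : Zloc p) ^ r₁ + (α : Zloc p) * a.1 ∧
    (p : Zloc p) ^ (r₂ + r₃) ∣ ((p : Zloc p) ^ r₂ - (α : Zloc p) * a₃) * a.1 +
      (β : Zloc p) * (p : Zloc p) ^ r₂ * a.2 - (p : Zloc p) ^ r₁ * a₃}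

/-- The set of cosets of `p^{r₃}ℤ_p` contained in `S(r₂, r₃)`. -/
def Sbar (p : ℕ) [Fact p.Prime] (α β : ℤ) (r₂ r₃ : ℕ) :
    Set (Zloc p ⧸ Ideal.span {(p : Zloc p) ^ r₃}) :=
  {c | ∀ a : Zloc p, Ideal.Quotient.mk _ a = c → a ∈ S p α β r₂ r₃}

/-- The submodule `ℤ_p(p^{r₂}, a) + ℤ_p(0, p^{r₃})` of `ℤ_p²`. -/
abbrev K (p : ℕ) [Fact p.Prime] (r₂ r₃ : ℕ) (a : Zloc p) :
    Submodule (Zloc p) (Zloc p × Zloc p) :=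
  Submodule.span (Zloc p) {((p : Zloc p) ^ r₂, a), (0, (p : Zloc p) ^ r₃)}

/-- The set of cosets of `ℤ_p(p^{r₂}, a) + ℤ_p(0, p^{r₃})` contained in `S(r₁, r₂, r₃, a)`. -/
def SSbar (p : ℕ) [Fact p.Prime] (α β : ℤ) (r₁ r₂ r₃ : ℕ) (a : Zloc p) :
    Set ((Zloc p × Zloc p) ⧸ K p r₂ r₃ a) :=
  {c | ∀ y : Zloc p × Zloc p, Submodule.Quotient.mk y = c → y ∈ SS p α β r₁ r₂ r₃ a}

/-- A representative of a coset of `p^{r₃}ℤ_p`. -/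
def rep (p : ℕ) [Fact p.Prime] (r₃ : ℕ) (c : Zloc p ⧸ Ideal.span {(p : Zloc p) ^ r₃}) :
    Zloc p :=
  Function.surjInv Ideal.Quotient.mk_surjective c

/-- `∑_{ā ∈ S̄(r₂, r₃)} |S̄(r₁, r₂, r₃, a)|` (a finite sum of cardinalities of finite sets, whose
terms do not depend on the representative `a` of `ā`). -/
def count (p : ℕ) [Fact p.Prime] (α β : ℤ) (r₁ r₂ r₃ : ℕ) : ℕ :=
  ∑ᶠ c ∈ Sbar p α β r₂ r₃, (SSbar p α β r₁ r₂ r₃ (rep p r₃ c)).ncard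

/-- The operator `E(r₂, r₃) = ∑_{ā ∈ S̄(r₂, r₃)} ∑_{r₁ ∈ C(r₂, r₃, a)} |S̄(r₁, r₂, r₃, a)|`, where
`C(r₂, r₃, a)` is the set of `r₁` with `S̄(r₁, r₂, r₃, a) ≠ ∅`. The term for `r₁` acts as its
cardinality times `X ^ r₁`, `X = p^{-s}`; the `r₁` outside `C(r₂, r₃, a)` contribute `0`. -/
def E (p : ℕ) [Fact p.Prime] (α β : ℤ) (r₂ r₃ : ℕ) : PowerSeries ℤ :=
  PowerSeries.mk fun r₁ => (count p α β r₁ r₂ r₃ : ℤ)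

/-! ### Regions and explicit formulas. Here `A = [α] = [β]` and `D = [β - α]`. -/

/-- The six regions of pairs `q = (r₃, r₂)`. -/
def region (A D : ℕ) : Fin 6 → Set (ℕ × ℕ)
  | 0 => {q | D + A ≤ q.2 ∧ D + A ≤ q.1}
  | 1 => {q | D ≤ q.1 ∧ D ≤ q.2 ∧ q.2 < min (D + A) q.1}
  | 2 => {q | A ≤ q.1 ∧ q.1 < D + A ∧ q.1 + A ≤ q.2}
  | 3 => {q | q.1 < A ∧ A + q.1 ≤ q.2}
  | 4 => {q | q.1 ≤ q.2 ∧ q.2 < A}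
  | 5 => {q | q.1 < D + A ∧ max A q.1 ≤ q.2 ∧ q.2 < A + q.1}

/-- `p^k - ⌊p^{k-1}⌋` (natural number division rounds down). -/
def cosets (p k : ℕ) : ℤ := (p ^ k : ℕ) - (p ^ k / p : ℕ)

/-- The explicit value of `E(r₂, r₃)` on each of the six regions, written in terms of a symbol
`T l` that stands for `∑_{r₁ ≥ l}`. -/
def explicitE {B : Type} [CommRing B] (T : ℕ → B) (p A D r₂ r₃ : ℕ) : Fin 6 → B
  | 0 => (p : B) ^ (2 * A + D) * T (2 * A)
  | 1 => (p : B) ^ (r₂ + A) * T (r₂ - D + A)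
  | 2 => ∑ i ∈ Finset.Ico (r₃ - D) A, (p : B) ^ (A + i) * (cosets p (r₃ - i) : B) * T (A + i) +
      (p : B) ^ (A + r₃) * T (2 * A)
  | 3 => ∑ i ∈ Finset.range (r₃ + 1), (p : B) ^ (A + i) * (cosets p (r₃ - i) : B) * T (A + i)
  | 4 => (p : B) ^ (r₂ + r₃) * T r₂
  | 5 =>
      ∑ i ∈ Finset.Ico (r₃ - D) (r₂ - A),
        (p : B) ^ min (A + i) (min (2 * A) (r₃ + A)) * (cosets p (r₃ - i) : B) *
          T (min (A + i) (min (2 * A) (r₃ + A))) +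
      ∑ j ∈ Finset.range (r₃ + A - r₂ + 1),
        (p : B) ^ min (r₂ + j) (min (2 * A) (r₃ + A)) *
          ((p : B) ^ (r₃ + A - r₂ - j) -
            (if j = 0 then 2 else 1) * ((p ^ (r₃ + A - r₂ - j) / p : ℕ) : B)) *
          T (min (r₂ + j) (min (2 * A) (r₃ + A))) +
      (p : B) ^ min r₂ (min (2 * A) (r₃ + A)) * (p : B) ^ (r₃ + A - r₂ - 1) *
        T (min r₂ (min (2 * A) (r₃ + A)))

/-- The power series `∑_{r₁ ≥ l} X ^ r₁`. -/
def tail (l : ℕ) : PowerSeries ℤ := PowerSeries.mk fun n => if l ≤ n then 1 else 0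

/-- The polynomials `N_i` such that the region `R_i` contributes `N_i(x) / (1 - x)^3`. In
`explicitE`, the symbol `∑_{r₁ ≥ l}` is replaced by the numerator `X ^ l` of `X ^ l / (1 - X)`. -/
def numer (p A D : ℕ) : Fin 6 → Polynomial ℤ
  | 0 => (p : Polynomial ℤ) ^ (2 * A + D) * Polynomial.X ^ (2 * (2 * A + D))
  | 1 => (1 - Polynomial.X) * ∑ r₂ ∈ Finset.Ico D (D + A),
      (p : Polynomial ℤ) ^ (r₂ + A) * Polynomial.X ^ (3 * r₂ + 1 + A - D)
  | 2 => (1 - Polynomial.X) * ∑ r₃ ∈ Finset.Ico A (D + A),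
      Polynomial.X ^ (2 * r₃ + A) *
        (∑ i ∈ Finset.Ico (r₃ - D) A, (p : Polynomial ℤ) ^ (A + i) *
            Polynomial.C (cosets p (r₃ - i)) * Polynomial.X ^ (A + i) +
          (p : Polynomial ℤ) ^ (A + r₃) * Polynomial.X ^ (2 * A))
  | 3 => (1 - Polynomial.X) * ∑ r₃ ∈ Finset.range A,
      Polynomial.X ^ (2 * r₃ + A) *
        ∑ i ∈ Finset.range (r₃ + 1), (p : Polynomial ℤ) ^ (A + i) *
          Polynomial.C (cosets p (r₃ - i)) * Polynomial.X ^ (A + i)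
  | 4 => (1 - Polynomial.X) ^ 2 * ∑ r₂ ∈ Finset.range A, ∑ r₃ ∈ Finset.range (r₂ + 1),
      (p : Polynomial ℤ) ^ (r₂ + r₃) * Polynomial.X ^ (2 * r₂ + r₃)
  | 5 => (1 - Polynomial.X) ^ 2 * ∑ r₃ ∈ Finset.range (D + A),
      ∑ r₂ ∈ Finset.Ico (max A r₃) (A + r₃),
        Polynomial.X ^ (r₂ + r₃) * explicitE (fun l => Polynomial.X ^ l) p A D r₂ r₃ 5

end

end IdealZeta

/-! In the basis `1`, `x`, `x(x - α)` of `R`, multiplication by `x` is the triangular map `shift`,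
so ideals are the `shift`-stable `ℤ_p`-sublattices of `ℤ_p³`. As `ℤ_p` is a discrete valuation ring,
each full sublattice has a unique Hermite normal form with rows `(p^r₁, c)`, `(0, p^r₂, a)`, `(0, 0,
p^r₃)`, where `a` and `c` matter only modulo the rows below. Its index is `p^(r₁+r₂+r₃)`. Stability
is tested on the rows and amounts to `a ∈ S(r₂, r₃)` and `c ∈ S(r₁, r₂, r₃, a)`
(`shift_mem_lattice_iff`), so the number of ideals of index `p^n` is the sum of `e(r₁, r₂, r₃)` over
`r₁ + r₂ + r₃ = n` (`exists_finset_ideals`).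

All these cosets have representatives among natural numbers, which makes `e` a count of solutions of
congruences in `ℤ`. For fixed `a`, put `w(a) = min(v(p^r₂ - αa), A + min(A, r₃))`, with `v` the
`p`-adic valuation. The congruences for `c` have `p^w(a)` solutions if `w(a) ≤ r₁` and none
otherwise (`card_tops`); hence `E(r₂, r₃) = ∑_a p^w(a) T_w(a)` (`E_eq_sum`).

It remains to find how `w(a)` is distributed over the slopes `a`. When `r₂` and `r₃` are both at
least `D + A`, or when `D ≤ r₂ < min(D + A, r₃)`, the identity `(β - α)(p^r₂ - αa) = βp^r₂ - α(p^r₂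
+ a(β - α))` shows that `w` is constant. If `r₃ ≤ r₂`, the slopes are the multiples of `p^(r₃ - D)`,
and `w` depends on the distance from `a` to `0` or to an approximate root `x₀` of `p^r₂ = αx`;
residues are counted ring by ring (`sum_filter_dvd_sub`). If `r₂ < min(D, r₃)`, there are no slopes,
and every other pair lies in exactly one region.

Each `T_l` equals `X^l/(1 - X)`, and each region is a quadrant, a finite union of half-lines, or
finite, so its sum is a polynomial over `(1 - X)³`. The coefficients being nonnegative, the formal
identities can be evaluated at every `|X| < 1` with absolute convergence (`hasSum_eval`). -/

namespace IdealZeta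

/-! ### Arithmetic of the localization `ℤ_p` -/

section Localization

variable (p : ℕ) [hp : Fact p.Prime]

/-- `p` is prime as an integer. -/
theorem prime_int : Prime (p : ℤ) := Nat.prime_iff_prime_int.mp hp.out

instance isDVR_Zloc : IsDiscreteValuationRing (Zloc p) :=
  IsLocalization.AtPrime.isDiscreteValuationRing_of_dedekind_domain ℤ
    (P := Ideal.span {(p : ℤ)}) (by simp [hp.out.ne_zero]) (Zloc p)

theorem irreducible_p : Irreducible (p : Zloc p) := by
  rw [IsDiscreteValuationRing.irreducible_iff_uniformizer,
    ← Localization.AtPrime.map_eq_maximalIdeal, Ideal.map_span]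
  simp

instance charZero_Zloc : CharZero (Zloc p) :=
  charZero_of_injective_algebraMap (IsLocalization.injective (Zloc p)
    (Ideal.primeCompl_le_nonZeroDivisors (Ideal.span {(p : ℤ)})))

theorem exists_int_mul_eq (x : Zloc p) :
    ∃ m s : ℤ, ¬ (p : ℤ) ∣ s ∧ (s : Zloc p) * x = m := by
  obtain ⟨⟨m, s⟩, h⟩ := IsLocalization.surj (Ideal.span {(p : ℤ)}).primeCompl x
  refine ⟨m, s, ?_, ?_⟩
  · have := s.2
    simpa [Ideal.primeCompl, Ideal.mem_span_singleton] using this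
  · simpa [mul_comm] using h

variable {p}

theorem isCoprime_pow {u : ℤ} (hu : ¬ (p : ℤ) ∣ u) (k : ℕ) : IsCoprime ((p : ℤ) ^ k) u :=
  ((prime_int p).coprime_iff_not_dvd.mpr hu).pow_left

/-- Denominators are prime to `p`, so they can be cancelled from a divisibility by `p ^ k`. This is
what moves the counting from `ℤ_p` to `ℤ`. -/
theorem pow_dvd_intCast_iff (k : ℕ) (m : ℤ) :
    (p : Zloc p) ^ k ∣ (m : Zloc p) ↔ (p : ℤ) ^ k ∣ m := by
  constructor
  · rintro ⟨x, hx⟩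
    obtain ⟨n, s, hs, h⟩ := exists_int_mul_eq p x
    have : ((s * m : ℤ) : Zloc p) = ((p ^ k * n : ℤ) : Zloc p) := by
      push_cast
      rw [hx, ← h]; ring
    have h2 : s * m = p ^ k * n := by exact_mod_cast this
    exact (isCoprime_pow hs k).dvd_of_dvd_mul_left ⟨n, h2⟩
  · rintro ⟨x, rfl⟩
    exact ⟨x, by push_cast; ring⟩

/-- Every element of `ℤ_p` is congruent modulo `p ^ k` to exactly one of `0, …, p ^ k - 1`. -/
theorem exists_natRep (k : ℕ) (x : Zloc p) :
    ∃ n < p ^ k, (p : Zloc p) ^ k ∣ x - n := by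
  obtain ⟨m, s, hs, h⟩ := exists_int_mul_eq p x
  obtain ⟨u, v, huv⟩ := isCoprime_pow hs k
  have hpk : (0 : ℤ) < (p : ℤ) ^ k := by have := hp.out.pos; positivity
  -- From `u p^k + v s = 1` and `s x = m`, one gets `x ≡ v s x = v m` modulo `p^k`.
  refine ⟨((v * m) % (p ^ k)).toNat, ?_, ?_⟩
  · have := Int.emod_lt_of_pos (v * m) hpk
    have h0 := Int.emod_nonneg (v * m) hpk.ne'
    zify
    rw [Int.toNat_of_nonneg h0]
    exact this
  · have h0 := Int.emod_nonneg (v * m) hpk.ne'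
    have e : (((((v * m) % (p ^ k)).toNat : ℕ)) : Zloc p) = (((v * m) % (p ^ k) : ℤ) : Zloc p) := by
      rw [← Int.cast_natCast, Int.toNat_of_nonneg h0]
    rw [e, Int.emod_def]
    refine ⟨x * u + ((v * m / p ^ k : ℤ) : Zloc p), ?_⟩
    have e2 : ((u * p ^ k + v * s : ℤ) : Zloc p) = 1 := by rw [huv]; simp
    push_cast at e2 ⊢
    rw [← h]
    linear_combination (-x) * e2

theorem natRep_unique {k m n : ℕ} (hm : m < p ^ k) (hn : n < p ^ k)
    (h : (p : Zloc p) ^ k ∣ (m : Zloc p) - n) : m = n := by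
  have : ((p : ℤ)) ^ k ∣ (m : ℤ) - n := by
    rw [← pow_dvd_intCast_iff]; simpa using h
  have h2 : (n : ℤ) ≡ m [ZMOD ((p ^ k : ℕ) : ℤ)] := by
    rw [Int.modEq_iff_dvd]; exact_mod_cast this
  have h3 := Int.natCast_modEq_iff.mp h2
  exact (Nat.ModEq.eq_of_lt_of_lt h3 hn hm).symm

theorem p_pow_ne_zero (k : ℕ) : (p : Zloc p) ^ k ≠ 0 := pow_ne_zero _ (irreducible_p p).ne_zero

theorem span_pow_injective {m n : ℕ}
    (h : Ideal.span {(p : Zloc p) ^ m} = Ideal.span {(p : Zloc p) ^ n}) : m = n := by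
  rw [Ideal.span_singleton_eq_span_singleton] at h
  have hi := (irreducible_p p)
  exact le_antisymm ((pow_dvd_pow_iff hi.ne_zero hi.not_isUnit).mp h.dvd)
    ((pow_dvd_pow_iff hi.ne_zero hi.not_isUnit).mp h.symm.dvd)

theorem exists_eq_span_pow {I : Ideal (Zloc p)} (hI : I ≠ ⊥) :
    ∃ n : ℕ, I = Ideal.span {(p : Zloc p) ^ n} :=
  IsDiscreteValuationRing.ideal_eq_span_pow_irreducible hI (irreducible_p p)

end Localization

/-! ### Triangular submodules of `ℤ_p × M`: one step of the Hermite normal form -/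

section Glue

variable {p : ℕ} [hp : Fact p.Prime] {M : Type} [AddCommGroup M] [Module (Zloc p) M]

/-- A submodule is full if every vector has a nonzero integer multiple in it. -/
def FullSub (L : Submodule (Zloc p) M) : Prop := ∀ v : M, ∃ n : ℕ, n ≠ 0 ∧ n • v ∈ L

/-- The submodule of `ℤ_p × M` generated by `(p ^ r, c)` and `0 × N`. -/
def glue (r : ℕ) (N : Submodule (Zloc p) M) (c : M) : Submodule (Zloc p) (Zloc p × M) where
  carrier := {v | ∃ t : Zloc p, v.1 = t * (p : Zloc p) ^ r ∧ v.2 - t • c ∈ N}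
  add_mem' := by
    rintro v w ⟨t, ht, hv⟩ ⟨u, hu, hw⟩
    refine ⟨t + u, by simp [ht, hu, add_mul], ?_⟩
    have := N.add_mem hv hw
    rw [Prod.snd_add, add_smul]
    convert this using 1
    abel
  zero_mem' := ⟨0, by simp, by simp⟩
  smul_mem' := by
    rintro a v ⟨t, ht, hv⟩
    refine ⟨a * t, by simp [ht, mul_assoc], ?_⟩
    have := N.smul_mem a hv
    rwa [smul_sub, smul_smul] at this

theorem mem_glue {r : ℕ} {N : Submodule (Zloc p) M} {c : M} {v : Zloc p × M} :
    v ∈ glue r N c ↔ ∃ t : Zloc p, v.1 = t * (p : Zloc p) ^ r ∧ v.2 - t • c ∈ N := Iff.rfl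

theorem gen_mem_glue (r : ℕ) (N : Submodule (Zloc p) M) (c : M) :
    ((p : Zloc p) ^ r, c) ∈ glue r N c := ⟨1, by simp, by simp⟩

theorem inr_mem_glue {r : ℕ} {N : Submodule (Zloc p) M} {c y : M} :
    ((0, y) : Zloc p × M) ∈ glue r N c ↔ y ∈ N := by
  rw [mem_glue]
  constructor
  · rintro ⟨t, ht, hy⟩
    obtain rfl : t = 0 := by
      rcases mul_eq_zero.mp ht.symm with h | h
      · exact h
      · exact absurd h (p_pow_ne_zero r)
    simpa using hy
  · intro h
    exact ⟨0, by simp, by simpa using h⟩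

theorem mem_glue_of_gen {r : ℕ} {N : Submodule (Zloc p) M} {c c' : M}
    (h : ((p : Zloc p) ^ r, c') ∈ glue r N c) : c' - c ∈ N := by
  have := (glue r N c).sub_mem h (gen_mem_glue r N c)
  rw [Prod.mk_sub_mk, sub_self] at this
  exact inr_mem_glue.mp this

theorem glue_le_iff {r : ℕ} {N : Submodule (Zloc p) M} {c : M}
    {L : Submodule (Zloc p) (Zloc p × M)} :
    glue r N c ≤ L ↔ ((p : Zloc p) ^ r, c) ∈ L ∧ ∀ y ∈ N, ((0, y) : Zloc p × M) ∈ L := by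
  constructor
  · intro h
    exact ⟨h (gen_mem_glue r N c), fun y hy => h (inr_mem_glue.mpr hy)⟩
  · rintro ⟨h1, h2⟩ ⟨s, y⟩ ⟨t, ht, hy⟩
    have := L.add_mem (L.smul_mem t h1) (h2 _ hy)
    simp only at ht
    simpa [ht] using this

theorem glue_congr {r : ℕ} {N : Submodule (Zloc p) M} {c c' : M} (h : c' - c ∈ N) :
    glue r N c' = glue r N c := by
  apply le_antisymm <;> rw [glue_le_iff]
  · refine ⟨⟨1, by simp, by simpa using h⟩, fun y hy => inr_mem_glue.mpr hy⟩
  · refine ⟨⟨1, by simp, ?_⟩, fun y hy => inr_mem_glue.mpr hy⟩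
    have := N.neg_mem h
    simpa using this

/-- The submodule recovers its data: `p ^ r` generates the projection to the first factor, `N` is
the intersection with `0 × M`, and two elements over `p ^ r` differ by an element of `N`. -/
theorem glue_injective {r r' : ℕ} {N N' : Submodule (Zloc p) M} {c c' : M}
    (h : glue r N c = glue r' N' c') : r = r' ∧ N = N' ∧ c - c' ∈ N' := by
  have key : ∀ {r r' : ℕ} {N N' : Submodule (Zloc p) M} {c c' : M},
      glue r N c = glue r' N' c' → r' ≤ r := by
    intro r r' N N' c c' h
    obtain ⟨t, ht, -⟩ := h ▸ gen_mem_glue r N c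
    have hi := irreducible_p p
    exact (pow_dvd_pow_iff hi.ne_zero hi.not_isUnit).mp ⟨t, by rw [mul_comm]; exact ht⟩
  obtain rfl : r = r' := le_antisymm (key h.symm) (key h)
  refine ⟨rfl, ?_, ?_⟩
  · ext y
    rw [← inr_mem_glue (r := r) (c := c), h, inr_mem_glue]
  · exact mem_glue_of_gen (h ▸ gen_mem_glue r N c)

theorem fullSub_glue {r : ℕ} {N : Submodule (Zloc p) M} {c : M} (hN : FullSub N) :
    FullSub (glue r N c) := by
  rintro ⟨s, y⟩
  obtain ⟨n, hn, h⟩ := hN ((p : Zloc p) ^ r • y - s • c)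
  refine ⟨n * p ^ r, mul_ne_zero hn (pow_ne_zero _ hp.out.ne_zero), n • s, ?_, ?_⟩
  · simp [mul_comm, mul_left_comm]
  · convert h using 1
    rw [smul_sub, Prod.smul_snd, mul_smul, smul_assoc]
    congr 2
    rw [← Nat.cast_smul_eq_nsmul (Zloc p)]
    simp

/-- Fullness makes the first projection of `L` a nonzero ideal, hence generated by some `p ^ r`. Any
lift `c` of that generator, together with the part of `L` inside `0 × M`, generates `L`. -/
theorem exists_eq_glue {L : Submodule (Zloc p) (Zloc p × M)} (hL : FullSub L) :
    ∃ (r : ℕ) (N : Submodule (Zloc p) M) (c : M), FullSub N ∧ L = glue r N c := by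
  let I : Ideal (Zloc p) := L.map (LinearMap.fst (Zloc p) (Zloc p) M)
  have hI : I ≠ ⊥ := by
    obtain ⟨n, hn, h⟩ := hL (1, 0)
    intro h0
    have : (n : Zloc p) ∈ I := ⟨_, h, by simp⟩
    rw [h0, Ideal.mem_bot] at this
    exact hn (by exact_mod_cast this)
  obtain ⟨r, hr⟩ := exists_eq_span_pow hI
  have h1 : (p : Zloc p) ^ r ∈ I := hr ▸ Ideal.mem_span_singleton_self _
  obtain ⟨⟨s, c⟩, hc, hs⟩ := h1
  obtain rfl : s = (p : Zloc p) ^ r := hs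
  refine ⟨r, L.comap (LinearMap.inr (Zloc p) (Zloc p) M), c, ?_, le_antisymm ?_ ?_⟩
  · intro y
    obtain ⟨n, hn, h⟩ := hL (0, y)
    exact ⟨n, hn, by simpa using h⟩
  · rintro ⟨s, y⟩ h
    have h2 : s ∈ I := ⟨_, h, rfl⟩
    rw [hr, Ideal.mem_span_singleton'] at h2
    obtain ⟨t, rfl⟩ := h2
    refine ⟨t, rfl, ?_⟩
    have := L.sub_mem h (L.smul_mem t hc)
    simpa using this
  · rw [glue_le_iff]
    exact ⟨hc, fun y hy => hy⟩

/-- Subtracting multiples of `(p ^ r, c)` brings the first coordinate into `[0, p ^ r)`; the second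
is then determined modulo `N`. The resulting bijection also covers an infinite `M ⧸ N`. -/
theorem card_quotient_glue (r : ℕ) (N : Submodule (Zloc p) M) (c : M) :
    Nat.card ((Zloc p × M) ⧸ glue r N c) = p ^ r * Nat.card (M ⧸ N) := by
  let f : Fin (p ^ r) × (M ⧸ N) → (Zloc p × M) ⧸ glue r N c :=
    fun x => Submodule.Quotient.mk (((x.1 : ℕ) : Zloc p), x.2.out)
  have hf : Function.Bijective f := by
    constructor
    · rintro ⟨i, x⟩ ⟨j, y⟩ h
      obtain ⟨t, ht, h2⟩ := (Submodule.Quotient.eq _).mp h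
      simp only [Prod.mk_sub_mk] at ht h2
      have hij : i = j := Fin.ext (natRep_unique i.2 j.2 ⟨t, by rw [ht, mul_comm]⟩)
      subst hij
      have ht0 : t = 0 := by
        rcases mul_eq_zero.mp (ht.symm.trans (sub_self _)) with h | h
        · exact h
        · exact absurd h (p_pow_ne_zero r)
      rw [ht0, zero_smul, sub_zero, ← Submodule.Quotient.eq] at h2
      have ex : ∀ z : M ⧸ N, (Submodule.Quotient.mk z.out : M ⧸ N) = z := fun z => z.out_eq
      rw [ex, ex] at h2
      rw [h2]
    · intro z
      obtain ⟨⟨s, y⟩, rfl⟩ := Submodule.Quotient.mk_surjective _ z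
      obtain ⟨n, hn, t, ht⟩ := exists_natRep (p := p) r s
      refine ⟨(⟨n, hn⟩, Submodule.Quotient.mk (y - t • c)), ?_⟩
      symm
      rw [Submodule.Quotient.eq]
      refine ⟨t, by simpa [mul_comm] using ht, ?_⟩
      have ex : ∀ z : M ⧸ N, (Submodule.Quotient.mk z.out : M ⧸ N) = z := fun z => z.out_eq
      have := (Submodule.Quotient.eq N).mp (ex (Submodule.Quotient.mk (y - t • c))).symm
      simp only [Prod.mk_sub_mk]
      convert this using 1
      abel
  rw [← Nat.card_eq_of_bijective f hf, Nat.card_prod, Nat.card_eq_fintype_card, Fintype.card_fin]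

theorem card_quotient_span_pow (r : ℕ) :
    Nat.card (Zloc p ⧸ Ideal.span {(p : Zloc p) ^ r}) = p ^ r := by
  let f : Fin (p ^ r) → Zloc p ⧸ Ideal.span {(p : Zloc p) ^ r} :=
    fun x => Ideal.Quotient.mk _ ((x : ℕ) : Zloc p)
  have hf : Function.Bijective f := by
    constructor
    · intro i j h
      have := Ideal.Quotient.eq.mp h
      rw [Ideal.mem_span_singleton] at this
      exact Fin.ext (natRep_unique i.2 j.2 this)
    · intro z
      obtain ⟨s, rfl⟩ := Ideal.Quotient.mk_surjective z
      obtain ⟨n, hn, ht⟩ := exists_natRep (p := p) r s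
      refine ⟨⟨n, hn⟩, ?_⟩
      symm
      rw [Ideal.Quotient.eq, Ideal.mem_span_singleton]
      exact ht
  rw [← Nat.card_eq_of_bijective f hf, Nat.card_eq_fintype_card, Fintype.card_fin]

theorem fullSub_span_pow (r : ℕ) : FullSub (Ideal.span {(p : Zloc p) ^ r}) := fun v =>
  ⟨p ^ r, pow_ne_zero _ hp.out.ne_zero, Ideal.mem_span_singleton.mpr ⟨v, by simp⟩⟩

theorem FullSub.exists_eq_span {I : Ideal (Zloc p)} (hI : FullSub I) :
    ∃ n : ℕ, I = Ideal.span {(p : Zloc p) ^ n} := by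
  apply exists_eq_span_pow
  rintro rfl
  obtain ⟨n, hn, h⟩ := hI 1
  rw [Ideal.mem_bot] at h
  exact hn (by simpa using h)

theorem K_eq_glue (r₂ r₃ : ℕ) (a : Zloc p) :
    K p r₂ r₃ a = glue r₂ (Ideal.span {(p : Zloc p) ^ r₃}) a := by
  apply le_antisymm
  · rw [Submodule.span_le]
    rintro v (rfl | rfl)
    · exact gen_mem_glue _ _ _
    · exact inr_mem_glue.mpr (Ideal.mem_span_singleton_self _)
  · rw [glue_le_iff]
    refine ⟨Submodule.subset_span (by simp), fun y hy => ?_⟩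
    obtain ⟨t, rfl⟩ := Ideal.mem_span_singleton'.mp hy
    have := (K p r₂ r₃ a).smul_mem t (Submodule.subset_span (Set.mem_insert_of_mem _ rfl))
    simpa using this

end Glue

/-! ### Stability under multiplication by `x` -/

section Lattices

variable {p : ℕ} [hp : Fact p.Prime]

/-- Multiplication by `x` on `R`, in coordinates with respect to `1`, `x`, `x(x - α)`. -/
def shift (p : ℕ) [Fact p.Prime] (α β : ℤ) (v : Zloc p × Zloc p × Zloc p) :
    Zloc p × Zloc p × Zloc p :=
  (0, v.1 + (α : Zloc p) * v.2.1, v.2.1 + (β : Zloc p) * v.2.2)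

theorem shift_add (α β : ℤ) (v w : Zloc p × Zloc p × Zloc p) :
    shift p α β (v + w) = shift p α β v + shift p α β w := by
  simp only [shift, Prod.fst_add, Prod.snd_add, Prod.mk_add_mk]
  congr 2 <;> ring

theorem shift_smul (α β : ℤ) (t : Zloc p) (v : Zloc p × Zloc p × Zloc p) :
    shift p α β (t • v) = t • shift p α β v := by
  simp only [shift, Prod.smul_fst, Prod.smul_snd, Prod.smul_mk, smul_eq_mul]
  refine Prod.ext (by simp) (Prod.ext ?_ ?_) <;> simp only <;> ring

/-- The submodule spanned by `(p ^ r₁, c)`, `(0, p ^ r₂, a)` and `(0, 0, p ^ r₃)`. -/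
abbrev lattice (r₁ r₂ r₃ : ℕ) (a : Zloc p) (c : Zloc p × Zloc p) :
    Submodule (Zloc p) (Zloc p × Zloc p × Zloc p) :=
  glue r₁ (glue r₂ (Ideal.span {(p : Zloc p) ^ r₃}) a) c

/-- By linearity it is enough to test the three generators. The last is multiplied by `β` and gives
no condition; the image of the second, reduced by `α` times that generator, gives the condition on
`a`; the first gives the condition on `c`. -/
theorem shift_mem_lattice_iff {α β : ℤ} {r₁ r₂ r₃ : ℕ} {a : Zloc p} {c : Zloc p × Zloc p} :
    (∀ v ∈ lattice r₁ r₂ r₃ a c, shift p α β v ∈ lattice r₁ r₂ r₃ a c) ↔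
      a ∈ S p α β r₂ r₃ ∧ c ∈ SS p α β r₁ r₂ r₃ a := by
  have hS : ((α : Zloc p) * (p : Zloc p) ^ r₂, (p : Zloc p) ^ r₂ + (β : Zloc p) * a) ∈
      glue r₂ (Ideal.span {(p : Zloc p) ^ r₃}) a ↔ a ∈ S p α β r₂ r₃ := by
    rw [mem_glue]
    simp only [Ideal.mem_span_singleton, S, Set.mem_ofPred_eq, smul_eq_mul]
    constructor
    · rintro ⟨t, ht, h⟩
      have := mul_right_cancel₀ (p_pow_ne_zero r₂) ht
      rw [← this] at h
      convert h using 1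
      ring
    · intro h
      exact ⟨α, rfl, by convert h using 1; ring⟩
  have hSS : ((p : Zloc p) ^ r₁ + (α : Zloc p) * c.1, c.1 + (β : Zloc p) * c.2) ∈
      glue r₂ (Ideal.span {(p : Zloc p) ^ r₃}) a ↔ c ∈ SS p α β r₁ r₂ r₃ a := by
    rw [mem_glue]
    simp only [Ideal.mem_span_singleton, SS, Set.mem_ofPred_eq, smul_eq_mul]
    -- Multiplying by `p ^ r₂` eliminates the coefficient `t`, which explains the modulus `p ^ (r₂ +
    -- r₃)` in `SS`.
    have key : ∀ t : Zloc p, (p : Zloc p) ^ r₁ + (α : Zloc p) * c.1 = t * (p : Zloc p) ^ r₂ →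
        ((p : Zloc p) ^ r₂ - (α : Zloc p) * a) * c.1 +
          (β : Zloc p) * (p : Zloc p) ^ r₂ * c.2 - (p : Zloc p) ^ r₁ * a =
        (p : Zloc p) ^ r₂ * (c.1 + (β : Zloc p) * c.2 - t * a) := by
      intro t ht
      linear_combination (-a) * ht
    constructor
    · rintro ⟨t, ht, h⟩
      refine ⟨⟨t, by rw [ht, mul_comm]⟩, ?_⟩
      rw [key t ht, pow_add]
      exact mul_dvd_mul_left _ h
    · rintro ⟨⟨t, ht⟩, h⟩
      replace ht := ht.trans (mul_comm _ _)
      refine ⟨t, ht, ?_⟩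
      rw [key t ht, pow_add] at h
      exact (mul_dvd_mul_iff_left (p_pow_ne_zero r₂)).mp h
  rw [← hS, ← hSS]
  constructor
  · intro h
    constructor
    · have h1 := h (0, ((p : Zloc p) ^ r₂, a)) (inr_mem_glue.mpr (gen_mem_glue _ _ _))
      have h2 := inr_mem_glue.mp h1
      simpa using h2
    · exact inr_mem_glue.mp (h _ (gen_mem_glue _ _ _))
  · rintro ⟨h1, h2⟩
    have hsub : lattice r₁ r₂ r₃ a c ≤
        (lattice r₁ r₂ r₃ a c).comap
          (⟨⟨shift p α β, shift_add α β⟩, shift_smul α β⟩ :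
            (Zloc p × Zloc p × Zloc p) →ₗ[Zloc p] _) := by
      rw [glue_le_iff]
      refine ⟨inr_mem_glue.mpr h2, ?_⟩
      rintro y ⟨t, ht, hy⟩
      obtain ⟨b, hb⟩ := Ideal.mem_span_singleton'.mp hy
      refine inr_mem_glue.mpr ?_
      have e : ((0 : Zloc p) + α * y.1, y.1 + (β : Zloc p) * y.2) =
          t • ((α : Zloc p) * (p : Zloc p) ^ r₂, (p : Zloc p) ^ r₂ + (β : Zloc p) * a) +
            (0, (β : Zloc p) * b * (p : Zloc p) ^ r₃) := by
        rw [Prod.smul_mk, Prod.mk_add_mk, smul_eq_mul, smul_eq_mul, ht]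
        rw [smul_eq_mul] at hb
        congr 1
        · ring
        · linear_combination (-(β : Zloc p)) * hb
      simp only
      rw [e]
      exact Submodule.add_mem _ (Submodule.smul_mem _ _ h1)
        (inr_mem_glue.mpr (Ideal.mem_span_singleton'.mpr ⟨_, rfl⟩))
    exact hsub

end Lattices

/-! ### Coordinates on `R`, and ideals as stable sublattices -/

section Coordinates

variable (p : ℕ) [hp : Fact p.Prime] (α β : ℤ)

open Polynomial

/-- The polynomial `x(x - α)(x - β)`. -/
noncomputable abbrev cubic : (Zloc p)[X] := X * (X - C (α : Zloc p)) * (X - C (β : Zloc p))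

theorem cubic_monic : (cubic p α β).Monic :=
  (monic_X.mul (monic_X_sub_C _)).mul (monic_X_sub_C _)

theorem cubic_degree : (cubic p α β).degree = 3 := by
  rw [cubic, degree_mul, degree_mul, degree_X, degree_X_sub_C, degree_X_sub_C]
  norm_num

/-- The polynomial `u + v x + w x(x - α)`. -/
noncomputable def coordPoly (v : Zloc p × Zloc p × Zloc p) : (Zloc p)[X] :=
  C v.1 + C v.2.1 * X + C v.2.2 * (X * (X - C (α : Zloc p)))

/-- The coordinates of `R` with respect to the basis `1`, `x`, `x(x - α)`. -/
noncomputable def coordMap : (Zloc p × Zloc p × Zloc p) →ₗ[Zloc p] R p α β where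
  toFun v := AdjoinRoot.mk (cubic p α β) (coordPoly p α v)
  map_add' v w := by
    rw [← map_add]
    congr 1
    simp only [coordPoly, Prod.fst_add, Prod.snd_add, map_add]
    ring
  map_smul' t v := by
    rw [RingHom.id_apply, Algebra.smul_def (A := AdjoinRoot _) t (AdjoinRoot.mk _ _),
      AdjoinRoot.algebraMap_eq, ← AdjoinRoot.mk_C, ← map_mul]
    congr 1
    simp only [coordPoly, Prod.smul_fst, Prod.smul_snd, smul_eq_mul, map_mul]
    ring

theorem coordMap_apply (v : Zloc p × Zloc p × Zloc p) :
    coordMap p α β v = AdjoinRoot.mk (cubic p α β) (coordPoly p α v) := rfl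

theorem coordPoly_degree_lt (v : Zloc p × Zloc p × Zloc p) : (coordPoly p α v).degree < 3 := by
  have : coordPoly p α v = C v.2.2 * X ^ 2 + C (v.2.1 - v.2.2 * α) * X + C v.1 := by
    simp only [coordPoly, map_sub, map_mul]; ring
  rw [this]
  exact degree_quadratic_lt

theorem coordMap_injective : Function.Injective (coordMap p α β) := by
  rw [← LinearMap.ker_eq_bot, LinearMap.ker_eq_bot']
  intro v hv
  rw [coordMap_apply, AdjoinRoot.mk_eq_zero] at hv
  have h0 := Polynomial.eq_zero_of_dvd_of_degree_lt hv
    (by rw [cubic_degree]; exact coordPoly_degree_lt p α v)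
  have e : coordPoly p α v = C v.2.2 * X ^ 2 + C (v.2.1 - v.2.2 * α) * X + C v.1 := by
    simp only [coordPoly, map_sub, map_mul]; ring
  rw [e] at h0
  have c2 := congrArg (fun q => coeff q 2) h0
  have c1 := congrArg (fun q => coeff q 1) h0
  have c0 := congrArg (fun q => coeff q 0) h0
  simp [coeff_X, coeff_C] at c0 c1 c2
  rw [c2] at c1
  simp at c1
  exact Prod.ext c0 (Prod.ext c1 c2)

theorem coordMap_surjective : Function.Surjective (coordMap p α β) := by
  intro z
  obtain ⟨q, rfl⟩ := AdjoinRoot.mk_surjective z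
  let g := q %ₘ cubic p α β
  have hg : g.degree < 3 := by
    rw [← cubic_degree p α β]; exact degree_modByMonic_lt _ (cubic_monic p α β)
  have hq : AdjoinRoot.mk (cubic p α β) q = AdjoinRoot.mk (cubic p α β) g := by
    rw [AdjoinRoot.mk_eq_mk]
    exact ⟨q /ₘ cubic p α β, by
      have := modByMonic_add_div q (cubic p α β)
      linear_combination -this⟩
  have hg3 : g = C (g.coeff 0) + C (g.coeff 1) * X + C (g.coeff 2) * X ^ 2 := by
    have h2 : g.natDegree < 3 := by
      by_cases h : g = 0
      · simp [h]
      · exact (natDegree_lt_iff_degree_lt h).mpr hg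
    conv_lhs => rw [g.as_sum_range_C_mul_X_pow' h2]
    simp [Finset.sum_range_succ]
  -- Rewrite `x² = x(x - α) + αx`.
  refine ⟨(g.coeff 0, g.coeff 1 + g.coeff 2 * α, g.coeff 2), ?_⟩
  rw [coordMap_apply]
  refine Eq.trans ?_ hq.symm
  congr 1
  conv_rhs => rw [hg3]
  simp only [coordPoly, map_add, map_mul]
  ring

theorem coordMap_shift (v : Zloc p × Zloc p × Zloc p) :
    coordMap p α β (shift p α β v) = AdjoinRoot.root _ * coordMap p α β v := by
  rw [coordMap_apply, coordMap_apply]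
  rw [← AdjoinRoot.mk_X, ← map_mul]
  rw [AdjoinRoot.mk_eq_mk]
  -- Only the last basis vector meets the relation: `x · x(x - α)` is `βx(x - α)` plus the cubic
  -- itself.
  refine ⟨-C v.2.2, ?_⟩
  simp only [coordPoly, shift, cubic, map_add, map_mul, map_zero]
  ring

/-- The coordinates of an ideal of `R`. -/
noncomputable def idealCoords (I : Ideal (R p α β)) : Submodule (Zloc p) (Zloc p × Zloc p × Zloc p) :=
  (I.restrictScalars (Zloc p)).comap (coordMap p α β)

variable {p α β}

theorem mem_idealCoords {I : Ideal (R p α β)} {v : Zloc p × Zloc p × Zloc p} :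
    v ∈ idealCoords p α β I ↔ coordMap p α β v ∈ I := Iff.rfl

theorem idealCoords_injective : Function.Injective (idealCoords p α β) := by
  intro I J h
  ext z
  obtain ⟨v, rfl⟩ := coordMap_surjective p α β z
  rw [← mem_idealCoords, h, mem_idealCoords]

theorem shift_mem_idealCoords (I : Ideal (R p α β)) :
    ∀ v ∈ idealCoords p α β I, shift p α β v ∈ idealCoords p α β I := by
  intro v hv
  rw [mem_idealCoords, coordMap_shift]
  exact I.mul_mem_left _ hv

/-- `R` is generated over `ℤ_p` by the class of `x`, so a `ℤ_p`-submodule closed under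
multiplication by `x` is an ideal; the proof is by induction on polynomials. -/
theorem exists_idealCoords_eq {L : Submodule (Zloc p) (Zloc p × Zloc p × Zloc p)}
    (hL : ∀ v ∈ L, shift p α β v ∈ L) : ∃ I : Ideal (R p α β), idealCoords p α β I = L := by
  have hroot : ∀ z ∈ L.map (coordMap p α β), AdjoinRoot.root _ * z ∈ L.map (coordMap p α β) := by
    rintro z ⟨v, hv, rfl⟩
    exact ⟨_, hL v hv, coordMap_shift p α β v⟩
  have hmul : ∀ (q : (Zloc p)[X]), ∀ z ∈ L.map (coordMap p α β),
      AdjoinRoot.mk _ q * z ∈ L.map (coordMap p α β) := by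
    intro q
    induction q using Polynomial.induction_on with
    | C a =>
      intro z hz
      have := (L.map (coordMap p α β)).smul_mem a hz
      rwa [Algebra.smul_def, AdjoinRoot.algebraMap_eq, ← AdjoinRoot.mk_C] at this
    | add f g hf hg =>
      intro z hz
      rw [map_add, add_mul]
      exact Submodule.add_mem _ (hf z hz) (hg z hz)
    | monomial n a h =>
      intro z hz
      have := hroot _ (h z hz)
      rw [pow_succ, ← mul_assoc, map_mul, AdjoinRoot.mk_X]
      rwa [← mul_assoc, mul_comm (AdjoinRoot.root _)] at this
  refine ⟨{ carrier := L.map (coordMap p α β)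
            add_mem' := fun h1 h2 => Submodule.add_mem _ h1 h2
            zero_mem' := Submodule.zero_mem _
            smul_mem' := ?_ }, ?_⟩
  · intro c z hz
    obtain ⟨q, rfl⟩ := AdjoinRoot.mk_surjective c
    exact hmul q z hz
  · ext v
    rw [mem_idealCoords]
    constructor
    · rintro ⟨w, hw, h⟩
      rwa [← coordMap_injective p α β h]
    · intro hv
      exact ⟨v, hv, rfl⟩

theorem isFull_iff (I : Ideal (R p α β)) : IsFull I ↔ FullSub (idealCoords p α β I) := by
  constructor
  · intro h v
    obtain ⟨n, hn, h⟩ := h (coordMap p α β v)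
    exact ⟨n, hn, by rwa [mem_idealCoords, map_nsmul]⟩
  · intro h z
    obtain ⟨v, rfl⟩ := coordMap_surjective p α β z
    obtain ⟨n, hn, h⟩ := h v
    exact ⟨n, hn, by rwa [mem_idealCoords, map_nsmul] at h⟩

theorem idx_eq_card (I : Ideal (R p α β)) :
    idx I = Nat.card ((Zloc p × Zloc p × Zloc p) ⧸ idealCoords p α β I) := by
  let f := Submodule.mapQ (idealCoords p α β I) (I.restrictScalars (Zloc p)) (coordMap p α β) le_rfl
  have hf : Function.Bijective f := by
    constructor
    · rw [← LinearMap.ker_eq_bot, LinearMap.ker_eq_bot']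
      intro x hx
      obtain ⟨v, rfl⟩ := Submodule.Quotient.mk_surjective _ x
      rw [show f (Submodule.Quotient.mk v) = Submodule.Quotient.mk (coordMap p α β v) from rfl,
        Submodule.Quotient.mk_eq_zero] at hx
      rwa [Submodule.Quotient.mk_eq_zero]
    · intro x
      obtain ⟨z, rfl⟩ := Submodule.Quotient.mk_surjective _ x
      obtain ⟨v, rfl⟩ := coordMap_surjective p α β z
      exact ⟨Submodule.Quotient.mk v, rfl⟩
  exact (Nat.card_eq_of_bijective f hf).symm

end Coordinates

/-! ### Counting full ideals by Hermite normal forms -/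

section NormalForms

variable {p : ℕ} [hp : Fact p.Prime] {α β : ℤ}

/-- The representatives in `[0, p ^ r₃)` of the cosets in `S̄(r₂, r₃)`. -/
def slopes (p : ℕ) (α β : ℤ) (r₂ r₃ : ℕ) : Finset ℕ :=
  {a ∈ Finset.range (p ^ r₃) | (p : ℤ) ^ r₃ ∣ (p : ℤ) ^ r₂ + a * (β - α)}

/-- The representatives in `[0, p ^ r₂) × [0, p ^ r₃)` of the cosets in `S̄(r₁, r₂, r₃, a)`. -/
def tops (p : ℕ) (α β : ℤ) (r₁ r₂ r₃ a : ℕ) : Finset (ℕ × ℕ) :=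
  {y ∈ Finset.range (p ^ r₂) ×ˢ Finset.range (p ^ r₃) |
    (p : ℤ) ^ r₂ ∣ (p : ℤ) ^ r₁ + α * y.1 ∧
    (p : ℤ) ^ (r₂ + r₃) ∣ ((p : ℤ) ^ r₂ - α * a) * y.1 + β * (p : ℤ) ^ r₂ * y.2 -
      (p : ℤ) ^ r₁ * a}

/-- The Hermite normal forms of the ideals of type `t = (r₁, r₂, r₃)`. -/
def normalForms (p : ℕ) (α β : ℤ) (t : ℕ × ℕ × ℕ) : Finset (Σ _ : ℕ, ℕ × ℕ) :=
  (slopes p α β t.2.1 t.2.2).sigma fun a => tops p α β t.1 t.2.1 t.2.2 a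

theorem natCast_mem_S {r₂ r₃ a : ℕ} :
    (a : Zloc p) ∈ S p α β r₂ r₃ ↔ (p : ℤ) ^ r₃ ∣ (p : ℤ) ^ r₂ + a * (β - α) := by
  rw [← pow_dvd_intCast_iff]
  simp [S]

theorem natCast_mem_SS {r₁ r₂ r₃ a : ℕ} {y : ℕ × ℕ} :
    ((y.1 : Zloc p), (y.2 : Zloc p)) ∈ SS p α β r₁ r₂ r₃ (a : Zloc p) ↔
    (p : ℤ) ^ r₂ ∣ (p : ℤ) ^ r₁ + α * y.1 ∧
    (p : ℤ) ^ (r₂ + r₃) ∣ ((p : ℤ) ^ r₂ - α * a) * y.1 + β * (p : ℤ) ^ r₂ * y.2 -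
      (p : ℤ) ^ r₁ * a := by
  rw [← pow_dvd_intCast_iff, ← pow_dvd_intCast_iff]
  simp [SS]

theorem lattice_congr {r₁ r₂ r₃ : ℕ} {a a' : Zloc p} {c c' : Zloc p × Zloc p}
    (ha : (p : Zloc p) ^ r₃ ∣ a' - a)
    (hc : c' - c ∈ glue r₂ (Ideal.span {(p : Zloc p) ^ r₃}) a) :
    lattice r₁ r₂ r₃ a' c' = lattice r₁ r₂ r₃ a c := by
  have h1 : glue r₂ (Ideal.span {(p : Zloc p) ^ r₃}) a' =
      glue r₂ (Ideal.span {(p : Zloc p) ^ r₃}) a :=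
    glue_congr (Ideal.mem_span_singleton.mpr ha)
  unfold lattice
  rw [h1]
  exact glue_congr hc

/-- Together the two conditions express stability of the lattice, and the lattice depends only on
the cosets of `a` and `c`. No computation with the congruences is needed. -/
theorem mem_S_SS_congr {r₁ r₂ r₃ : ℕ} {a a' : Zloc p} {c c' : Zloc p × Zloc p}
    (ha : (p : Zloc p) ^ r₃ ∣ a' - a)
    (hc : c' - c ∈ glue r₂ (Ideal.span {(p : Zloc p) ^ r₃}) a) :
    a' ∈ S p α β r₂ r₃ ∧ c' ∈ SS p α β r₁ r₂ r₃ a' ↔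
      a ∈ S p α β r₂ r₃ ∧ c ∈ SS p α β r₁ r₂ r₃ a := by
  rw [← shift_mem_lattice_iff, ← shift_mem_lattice_iff, lattice_congr ha hc]

theorem mem_S_congr {r₂ r₃ : ℕ} {a a' : Zloc p} (ha : (p : Zloc p) ^ r₃ ∣ a' - a) :
    a' ∈ S p α β r₂ r₃ ↔ a ∈ S p α β r₂ r₃ := by
  simp only [S, Set.mem_ofPred_eq]
  have e : (p : Zloc p) ^ r₂ + a' * ((β : Zloc p) - α) =
      (p : Zloc p) ^ r₂ + a * ((β : Zloc p) - α) + (a' - a) * ((β : Zloc p) - α) := by ring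
  rw [e]
  exact dvd_add_left (ha.mul_right _)

/-- The representative in `[0, p ^ r₂) × [0, p ^ r₃)` of a coset. -/
theorem exists_natRep_pair (r₂ r₃ : ℕ) (a : Zloc p) (c : Zloc p × Zloc p) :
    ∃ y : ℕ × ℕ, y.1 < p ^ r₂ ∧ y.2 < p ^ r₃ ∧
      ((y.1 : Zloc p), (y.2 : Zloc p)) - c ∈ glue r₂ (Ideal.span {(p : Zloc p) ^ r₃}) a := by
  obtain ⟨i, hi, t, ht⟩ := exists_natRep (p := p) r₂ c.1
  -- Reducing the first coordinate by `t` copies of `(p ^ r₂, a)` also shifts the second by `t * a`.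
  obtain ⟨j, hj, s, hs⟩ := exists_natRep (p := p) r₃ (c.2 - t * a)
  refine ⟨(i, j), hi, hj, -t, ?_, ?_⟩
  · simp only [Prod.fst_sub]
    linear_combination -ht
  · rw [Ideal.mem_span_singleton]
    refine ⟨-s, ?_⟩
    simp only [Prod.snd_sub, smul_eq_mul]
    linear_combination -hs

theorem natRep_pair_unique {r₂ r₃ : ℕ} {a : Zloc p} {y z : ℕ × ℕ} (hy : y.1 < p ^ r₂)
    (hy' : y.2 < p ^ r₃) (hz : z.1 < p ^ r₂) (hz' : z.2 < p ^ r₃)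
    (h : ((y.1 : Zloc p), (y.2 : Zloc p)) - ((z.1 : Zloc p), (z.2 : Zloc p)) ∈
      glue r₂ (Ideal.span {(p : Zloc p) ^ r₃}) a) : y = z := by
  obtain ⟨t, ht, hs⟩ := h
  simp only [Prod.mk_sub_mk] at ht hs
  have h1 : y.1 = z.1 := natRep_unique hy hz ⟨t, by rw [ht, mul_comm]⟩
  rw [h1, sub_self] at ht
  have ht0 : t = 0 := by
    rcases mul_eq_zero.mp ht.symm with h | h
    · exact h
    · exact absurd h (p_pow_ne_zero r₂)
  rw [ht0, zero_smul, sub_zero, Ideal.mem_span_singleton] at hs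
  exact Prod.ext h1 (natRep_unique hy' hz' hs)

/-- The sets `SS` for congruent slopes are compared through stability of the lattice, which involves
`S` as well; this is why `a` is required to be a slope. The bound also applies to an arbitrary
representative `a'`, so the choice made by `rep` is immaterial. -/
theorem ncard_SSbar {r₁ r₂ r₃ a : ℕ} (ha : a ∈ slopes p α β r₂ r₃) {a' : Zloc p}
    (h : (p : Zloc p) ^ r₃ ∣ a' - a) :
    (SSbar p α β r₁ r₂ r₃ a').ncard = (tops p α β r₁ r₂ r₃ a).card := by
  have haS : (a : Zloc p) ∈ S p α β r₂ r₃ := natCast_mem_S.mpr (Finset.mem_filter.mp ha).2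
  have haS' := (mem_S_congr h).mpr haS
  have hglue : glue r₂ (Ideal.span {(p : Zloc p) ^ r₃}) a' =
      glue r₂ (Ideal.span {(p : Zloc p) ^ r₃}) (a : Zloc p) :=
    glue_congr (Ideal.mem_span_singleton.mpr h)
  have hmem : ∀ y z : Zloc p × Zloc p,
      y - z ∈ K p r₂ r₃ a' → y ∈ SS p α β r₁ r₂ r₃ a' → z ∈ SS p α β r₁ r₂ r₃ (a : Zloc p) := by
    intro y z hyz hy
    rw [K_eq_glue, hglue] at hyz
    exact ((mem_S_SS_congr h hyz).mp ⟨haS', hy⟩).2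
  have hmem' : ∀ y z : Zloc p × Zloc p,
      y - z ∈ K p r₂ r₃ a' → z ∈ SS p α β r₁ r₂ r₃ (a : Zloc p) → y ∈ SS p α β r₁ r₂ r₃ a' := by
    intro y z hyz hy
    rw [K_eq_glue, hglue] at hyz
    exact ((mem_S_SS_congr h hyz).mpr ⟨haS, hy⟩).2
  rw [← Set.ncard_coe_finset]
  symm
  refine Set.ncard_congr
    (fun y _ => Submodule.Quotient.mk ((y.1 : Zloc p), (y.2 : Zloc p))) ?_ ?_ ?_
  · intro y hy z hz
    have hy2 := (Finset.mem_filter.mp hy).2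
    rw [Submodule.Quotient.eq] at hz
    exact hmem' _ _ hz (natCast_mem_SS.mpr hy2)
  · intro y z hy hz hyz
    have hy1 := Finset.mem_product.mp (Finset.mem_filter.mp hy).1
    have hz1 := Finset.mem_product.mp (Finset.mem_filter.mp hz).1
    rw [Submodule.Quotient.eq, K_eq_glue] at hyz
    simp only [Finset.mem_range] at hy1 hz1
    exact natRep_pair_unique hy1.1 hy1.2 hz1.1 hz1.2 hyz
  · intro b hb
    obtain ⟨c, rfl⟩ := Submodule.Quotient.mk_surjective _ b
    obtain ⟨y, hy1, hy2, hy⟩ := exists_natRep_pair r₂ r₃ a' c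
    have hc : c ∈ SS p α β r₁ r₂ r₃ a' := hb c rfl
    rw [← K_eq_glue] at hy
    refine ⟨y, ?_, (Submodule.Quotient.eq _).mpr hy⟩
    have hy' := neg_mem hy
    rw [neg_sub] at hy'
    simp only [tops, Finset.coe_filter, Set.mem_ofPred_eq, Finset.mem_product, Finset.mem_range]
    exact ⟨⟨hy1, hy2⟩, natCast_mem_SS.mp (hmem _ _ hy' hc)⟩

theorem count_eq_sum (r₁ r₂ r₃ : ℕ) :
    count p α β r₁ r₂ r₃ = ∑ a ∈ slopes p α β r₂ r₃, (tops p α β r₁ r₂ r₃ a).card := by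
  rw [← finsum_mem_coe_finset]
  symm
  refine finsum_mem_eq_of_bijOn
    (fun a : ℕ => Ideal.Quotient.mk (Ideal.span {(p : Zloc p) ^ r₃}) (a : Zloc p)) ⟨?_, ?_, ?_⟩ ?_
  · intro a ha x hx
    rw [Ideal.Quotient.eq, Ideal.mem_span_singleton] at hx
    exact (mem_S_congr hx).mpr (natCast_mem_S.mpr (Finset.mem_filter.mp ha).2)
  · intro a ha b hb hab
    have := Ideal.Quotient.eq.mp hab
    rw [Ideal.mem_span_singleton] at this
    exact natRep_unique (Finset.mem_range.mp (Finset.mem_filter.mp ha).1)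
      (Finset.mem_range.mp (Finset.mem_filter.mp hb).1) this
  · intro c hc
    obtain ⟨x, rfl⟩ := Ideal.Quotient.mk_surjective c
    obtain ⟨n, hn, h⟩ := exists_natRep (p := p) r₃ x
    refine ⟨n, ?_, ?_⟩
    · exact Finset.mem_coe.mpr (Finset.mem_filter.mpr ⟨Finset.mem_range.mpr hn,
        natCast_mem_S.mp ((mem_S_congr h).mp (hc x rfl))⟩)
    · symm
      rw [Ideal.Quotient.eq, Ideal.mem_span_singleton]
      exact h
  · intro a ha
    refine (ncard_SSbar ha ?_).symm
    have : Ideal.Quotient.mk (Ideal.span {(p : Zloc p) ^ r₃})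
        (rep p r₃ (Ideal.Quotient.mk _ (a : Zloc p))) = Ideal.Quotient.mk _ (a : Zloc p) :=
      Function.surjInv_eq _ _
    rwa [Ideal.Quotient.eq, Ideal.mem_span_singleton] at this

theorem card_normalForms (t : ℕ × ℕ × ℕ) :
    (normalForms p α β t).card = count p α β t.1 t.2.1 t.2.2 := by
  rw [normalForms, Finset.card_sigma, count_eq_sum]

theorem mem_normalForms {t : ℕ × ℕ × ℕ} {z : Σ _ : ℕ, ℕ × ℕ} :
    z ∈ normalForms p α β t ↔ (z.1 < p ^ t.2.2 ∧ z.2.1 < p ^ t.2.1 ∧ z.2.2 < p ^ t.2.2) ∧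
      ((z.1 : Zloc p) ∈ S p α β t.2.1 t.2.2 ∧
      ((z.2.1 : Zloc p), (z.2.2 : Zloc p)) ∈ SS p α β t.1 t.2.1 t.2.2 (z.1 : Zloc p)) := by
  rw [natCast_mem_S, natCast_mem_SS]
  simp only [normalForms, Finset.mem_sigma, slopes, tops, Finset.mem_filter, Finset.mem_product,
    Finset.mem_range]
  tauto

/-- The lattice with given Hermite normal form. -/
abbrev natLattice (p : ℕ) [Fact p.Prime] (t : ℕ × ℕ × ℕ) (z : Σ _ : ℕ, ℕ × ℕ) :
    Submodule (Zloc p) (Zloc p × Zloc p × Zloc p) :=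
  lattice t.1 t.2.1 t.2.2 (z.1 : Zloc p) ((z.2.1 : Zloc p), (z.2.2 : Zloc p))

theorem natLattice_injective {t t' : ℕ × ℕ × ℕ} {z z' : Σ _ : ℕ, ℕ × ℕ}
    (hz : z ∈ normalForms p α β t) (hz' : z' ∈ normalForms p α β t')
    (h : natLattice p t z = natLattice p t' z') : t = t' ∧ z = z' := by
  obtain ⟨h1, h2, h3⟩ := glue_injective h
  obtain ⟨h4, h5, h6⟩ := glue_injective h2
  have h7 := span_pow_injective h5
  obtain rfl : t = t' := Prod.ext h1 (Prod.ext h4 h7)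
  obtain ⟨⟨b1, b2, b3⟩, -⟩ := mem_normalForms.mp hz
  obtain ⟨⟨c1, c2, c3⟩, -⟩ := mem_normalForms.mp hz'
  refine ⟨rfl, ?_⟩
  have e1 : z.1 = z'.1 := natRep_unique b1 c1 (Ideal.mem_span_singleton.mp h6)
  have e2 : z.2 = z'.2 := natRep_pair_unique b2 b3 c2 c3 h3
  exact Sigma.ext e1 (heq_of_eq e2)

theorem fullSub_natLattice (t : ℕ × ℕ × ℕ) (z : Σ _ : ℕ, ℕ × ℕ) : FullSub (natLattice p t z) :=
  fullSub_glue (fullSub_glue (fullSub_span_pow _))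

theorem card_quotient_natLattice (t : ℕ × ℕ × ℕ) (z : Σ _ : ℕ, ℕ × ℕ) :
    Nat.card ((Zloc p × Zloc p × Zloc p) ⧸ natLattice p t z) = p ^ (t.1 + t.2.1 + t.2.2) := by
  rw [card_quotient_glue, card_quotient_glue, card_quotient_span_pow, pow_add, pow_add, mul_assoc]

theorem exists_ideal_natLattice {t : ℕ × ℕ × ℕ} {z : Σ _ : ℕ, ℕ × ℕ}
    (hz : z ∈ normalForms p α β t) :
    ∃ I : Ideal (R p α β), idealCoords p α β I = natLattice p t z :=
  exists_idealCoords_eq (shift_mem_lattice_iff.mpr (mem_normalForms.mp hz).2)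

/-- Splitting off one coordinate at a time gives a triangular basis; its entries are then reduced to
natural numbers below the diagonal entries of their columns. -/
theorem exists_normalForm {I : Ideal (R p α β)} (hI : IsFull I) :
    ∃ t, ∃ z ∈ normalForms p α β t, idealCoords p α β I = natLattice p t z := by
  obtain ⟨r₁, N, c, hN, hL⟩ := exists_eq_glue ((isFull_iff I).mp hI)
  obtain ⟨r₂, N', a, hN', rfl⟩ := exists_eq_glue hN
  obtain ⟨r₃, rfl⟩ := hN'.exists_eq_span
  obtain ⟨n, hn, h⟩ := exists_natRep (p := p) r₃ a
  have h' : (p : Zloc p) ^ r₃ ∣ (n : Zloc p) - a := by rw [dvd_sub_comm]; exact h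
  obtain ⟨y, hy1, hy2, hy⟩ := exists_natRep_pair r₂ r₃ a c
  have e := lattice_congr (r₁ := r₁) h' hy
  have hst := shift_mem_idealCoords I
  replace hL : _ = lattice r₁ r₂ r₃ a c := hL
  rw [hL, ← e] at hst
  exact ⟨(r₁, r₂, r₃), ⟨n, y⟩, mem_normalForms.mpr ⟨⟨hn, hy1, hy2⟩, shift_mem_lattice_iff.mp hst⟩,
    hL.trans e.symm⟩

theorem exists_idx_eq {I : Ideal (R p α β)} (hI : IsFull I) : ∃ n : ℕ, idx I = p ^ n := by
  obtain ⟨t, z, -, h⟩ := exists_normalForm hI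
  exact ⟨_, by rw [idx_eq_card, h, card_quotient_natLattice]⟩

/-- The triples of natural numbers with sum `n`. -/
def triples (n : ℕ) : Finset (ℕ × ℕ × ℕ) :=
  {t ∈ Finset.range (n + 1) ×ˢ Finset.range (n + 1) ×ˢ Finset.range (n + 1) |
    t.1 + t.2.1 + t.2.2 = n}

theorem mem_triples {n : ℕ} {t : ℕ × ℕ × ℕ} : t ∈ triples n ↔ t.1 + t.2.1 + t.2.2 = n := by
  simp only [triples, Finset.mem_filter, Finset.mem_product, Finset.mem_range]
  omega

/-- Existence and uniqueness of normal forms make ideals of index `p ^ n` correspond bijectively to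
normal forms of the types `(r₁, r₂, r₃)` of sum `n`. -/
theorem exists_finset_ideals (p : ℕ) [hp : Fact p.Prime] (α β : ℤ) (n : ℕ) :
    ∃ s : Finset (Ideal (R p α β)), (∀ I, I ∈ s ↔ IsFull I ∧ idx I = p ^ n) ∧
      s.card = ∑ t ∈ triples n, count p α β t.1 t.2.1 t.2.2 := by
  classical
  choose f hf using fun (x : Σ t : ℕ × ℕ × ℕ, normalForms p α β t) =>
    exists_ideal_natLattice x.2.2
  have hinj : Function.Injective f := by
    rintro ⟨t, z, hz⟩ ⟨t', z', hz'⟩ h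
    have := hf ⟨t, z, hz⟩
    rw [h, hf] at this
    obtain ⟨rfl, rfl⟩ := natLattice_injective hz' hz this
    rfl
  refine ⟨((triples n).sigma fun t => (normalForms p α β t).attach).image f, ?_, ?_⟩
  · intro I
    rw [Finset.mem_image]
    constructor
    · rintro ⟨⟨t, z, hz⟩, ht, rfl⟩
      rw [Finset.mem_sigma, mem_triples] at ht
      rw [isFull_iff, idx_eq_card, hf, card_quotient_natLattice]
      exact ⟨fullSub_natLattice _ _, by rw [ht.1]⟩
    · rintro ⟨hI, hn⟩
      obtain ⟨t, z, hz, h⟩ := exists_normalForm hI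
      refine ⟨⟨t, z, hz⟩, ?_, idealCoords_injective ((hf _).trans h.symm)⟩
      rw [idx_eq_card, h, card_quotient_natLattice] at hn
      rw [Finset.mem_sigma, mem_triples]
      exact ⟨Nat.pow_right_injective hp.out.two_le hn, Finset.mem_attach _ _⟩
  · rw [Finset.card_image_of_injective _ hinj, Finset.card_sigma]
    exact Finset.sum_congr rfl fun t _ => by rw [Finset.card_attach, card_normalForms]

end NormalForms

/-! ### Solving the congruences: `E(r₂, r₃)` as a sum over slopes -/

section Counting

/-- The largest `k ≤ L` such that `p ^ k` divides `x`. -/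
def level (p L : ℕ) (x : ℤ) : ℕ := Nat.findGreatest (fun k => (p : ℤ) ^ k ∣ x) L

theorem level_le (p L : ℕ) (x : ℤ) : level p L x ≤ L := Nat.findGreatest_le L

theorem pow_level_dvd (p L : ℕ) (x : ℤ) : (p : ℤ) ^ level p L x ∣ x :=
  Nat.findGreatest_spec (P := fun k => (p : ℤ) ^ k ∣ x) (Nat.zero_le L) (by simp)

theorem le_level_iff {p L k : ℕ} {x : ℤ} (hk : k ≤ L) : k ≤ level p L x ↔ (p : ℤ) ^ k ∣ x :=
  ⟨fun h => (pow_dvd_pow _ h).trans (pow_level_dvd p L x), fun h => Nat.le_findGreatest hk h⟩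

theorem level_eq {p L w : ℕ} {x : ℤ} (hw : w ≤ L)
    (h : ∀ k ≤ L, ((p : ℤ) ^ k ∣ x ↔ k ≤ w)) : level p L x = w :=
  le_antisymm ((h _ (level_le p L x)).mp (pow_level_dvd p L x))
    ((le_level_iff hw).mpr ((h w hw).mpr le_rfl))

variable {p : ℕ} [hp : Fact p.Prime]

theorem pow_dvd_mul_iff {A : ℕ} {u : ℤ} (hu : ¬ (p : ℤ) ∣ u) (k : ℕ) (y : ℤ) :
    (p : ℤ) ^ k ∣ (p : ℤ) ^ A * u * y ↔ (p : ℤ) ^ (k - A) ∣ y := by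
  have hp0 : (p : ℤ) ≠ 0 := (prime_int p).ne_zero
  rcases le_total k A with h | h
  · simp only [Nat.sub_eq_zero_of_le h, pow_zero, one_dvd, iff_true]
    rw [mul_assoc]
    exact (pow_dvd_pow _ h).mul_right _
  · obtain ⟨j, rfl⟩ := Nat.exists_eq_add_of_le h
    rw [pow_add, mul_assoc, mul_dvd_mul_iff_left (pow_ne_zero _ hp0), Nat.add_sub_cancel_left]
    exact ⟨fun h => (isCoprime_pow hu j).dvd_of_dvd_mul_left h, fun h => h.mul_left _⟩

theorem pow_dvd_pow_mul_iff (A k : ℕ) (y : ℤ) :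
    (p : ℤ) ^ k ∣ (p : ℤ) ^ A * y ↔ (p : ℤ) ^ (k - A) ∣ y := by
  have h1 : ¬ (p : ℤ) ∣ 1 := fun h => (prime_int p).not_isUnit (isUnit_of_dvd_one h)
  simpa using pow_dvd_mul_iff (A := A) h1 k y

theorem pow_dvd_pow_int_iff (k r : ℕ) : (p : ℤ) ^ k ∣ (p : ℤ) ^ r ↔ k ≤ r :=
  pow_dvd_pow_iff (prime_int p).ne_zero (prime_int p).not_isUnit

theorem card_filter_dvd_sub {k n : ℕ} (hk : k ≤ n) (x₀ : ℤ) :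
    ({x ∈ Finset.range (p ^ n) | (p : ℤ) ^ k ∣ ((x : ℕ) : ℤ) - x₀} : Finset ℕ).card =
      p ^ (n - k) := by
  have hpk : 0 < p ^ k := pow_pos hp.out.pos k
  have hpkz : (0 : ℤ) < (p : ℤ) ^ k := by exact_mod_cast hpk
  obtain ⟨m, hm, hmx⟩ : ∃ m : ℕ, m < p ^ k ∧ (p : ℤ) ^ k ∣ x₀ - m := by
    refine ⟨(x₀ % (p : ℤ) ^ k).toNat, ?_, ?_⟩
    · zify
      rw [Int.toNat_of_nonneg (Int.emod_nonneg _ hpkz.ne')]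
      exact Int.emod_lt_of_pos _ hpkz
    · rw [Int.toNat_of_nonneg (Int.emod_nonneg _ hpkz.ne')]
      exact Int.dvd_self_sub_emod
  have hcond : ∀ x : ℕ, (p : ℤ) ^ k ∣ (x : ℤ) - x₀ ↔ x % p ^ k = m := by
    intro x
    have e : (x : ℤ) - x₀ = ((x : ℤ) - m) - (x₀ - m) := by ring
    rw [e, dvd_sub_left hmx]
    have e2 : (p : ℤ) ^ k = ((p ^ k : ℕ) : ℤ) := by push_cast; rfl
    rw [e2, ← Int.modEq_iff_dvd, Int.natCast_modEq_iff]
    constructor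
    · intro h
      rw [← h, Nat.mod_eq_of_lt hm]
    · intro h
      rw [← h]
      exact Nat.mod_modEq _ _
  simp only [hcond]
  conv_rhs => rw [← Finset.card_range (p ^ (n - k))]
  have hn : p ^ n = p ^ k * p ^ (n - k) := by rw [← pow_add, Nat.add_sub_cancel' hk]
  refine Finset.card_nbij' (fun x => x / p ^ k) (fun j => m + p ^ k * j) ?_ ?_ ?_ ?_
  · intro x hx
    simp only [Finset.coe_filter, Finset.mem_range, Set.mem_ofPred_eq] at hx
    simp only [Finset.coe_range, Set.mem_Iio]
    rw [Nat.div_lt_iff_lt_mul hpk, mul_comm, ← hn]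
    exact hx.1
  · intro j hj
    simp only [Finset.coe_range, Set.mem_Iio] at hj
    simp only [Finset.coe_filter, Finset.mem_range, Set.mem_ofPred_eq]
    refine ⟨?_, by rw [Nat.add_mul_mod_self_left, Nat.mod_eq_of_lt hm]⟩
    rw [hn]
    calc m + p ^ k * j < p ^ k + p ^ k * j := by omega
      _ = p ^ k * (j + 1) := by ring
      _ ≤ _ := Nat.mul_le_mul_left _ hj
  · intro x hx
    simp only [Finset.coe_filter, Finset.mem_range, Set.mem_ofPred_eq] at hx
    simp only
    conv_rhs => rw [← Nat.mod_add_div x (p ^ k), hx.2]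
  · intro j _
    simp only
    rw [Nat.add_mul_div_left _ _ hpk, Nat.div_eq_of_lt hm, zero_add]

theorem exists_dvd_add_mul {A n : ℕ} {u e : ℤ} (hu : ¬ (p : ℤ) ∣ u)
    (he : (p : ℤ) ^ min A n ∣ e) : ∃ x : ℤ, (p : ℤ) ^ n ∣ e + (p : ℤ) ^ A * u * x := by
  rcases le_total A n with h | h
  · rw [min_eq_left h] at he
    obtain ⟨e', rfl⟩ := he
    obtain ⟨s, t, hst⟩ := isCoprime_pow hu n
    -- Since `s p^n + t u = 1`, the integer `t` inverts `u` modulo `p^n`.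
    refine ⟨-t * e', (p : ℤ) ^ A * e' * s, ?_⟩
    linear_combination (-(p : ℤ) ^ A * e') * hst
  · rw [min_eq_right h] at he
    exact ⟨0, by simpa using he⟩

/-- The number of solutions of a linear congruence modulo `p ^ n`. -/
theorem card_linear_congruence {A n : ℕ} {u e : ℤ} (hu : ¬ (p : ℤ) ∣ u) :
    ({x ∈ Finset.range (p ^ n) |
      (p : ℤ) ^ n ∣ e + (p : ℤ) ^ A * u * ((x : ℕ) : ℤ)} : Finset ℕ).card =
      if (p : ℤ) ^ min A n ∣ e then p ^ min A n else 0 := by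
  split_ifs with he
  · obtain ⟨x₀, hx₀⟩ := exists_dvd_add_mul hu he
    have : ∀ x : ℕ, (p : ℤ) ^ n ∣ e + (p : ℤ) ^ A * u * (x : ℤ) ↔
        (p : ℤ) ^ (n - A) ∣ (x : ℤ) - x₀ := by
      intro x
      rw [← pow_dvd_mul_iff hu n, ← dvd_sub_left hx₀]
      ring_nf
    simp only [this]
    rw [card_filter_dvd_sub (Nat.sub_le _ _)]
    congr 1
    omega
  · rw [Finset.card_eq_zero, Finset.filter_eq_empty_iff]
    intro x _ h
    apply he
    have h1 := (pow_dvd_pow (p : ℤ) (min_le_right A n)).trans h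
    rwa [dvd_add_left] at h1
    rw [mul_assoc]
    exact (pow_dvd_pow (p : ℤ) (min_le_left A n)).mul_right _

/-- The first coordinates of the representatives of `S̄(r₁, r₂, r₃, a)`. -/
theorem card_first_coordinates {A r₁ r₂ m : ℕ} {u a : ℤ} (hu : ¬ (p : ℤ) ∣ u) (hm : m ≤ r₂)
    (hmA : m ≤ A) :
    ({x ∈ Finset.range (p ^ r₂) |
      (p : ℤ) ^ r₂ ∣ (p : ℤ) ^ r₁ + (p : ℤ) ^ A * u * ((x : ℕ) : ℤ) ∧
      (p : ℤ) ^ (r₂ + m) ∣ ((p : ℤ) ^ r₂ - (p : ℤ) ^ A * u * a) * ((x : ℕ) : ℤ) -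
        (p : ℤ) ^ r₁ * a} : Finset ℕ).card =
      if level p (A + m) ((p : ℤ) ^ r₂ - (p : ℤ) ^ A * u * a) ≤ r₁ then
        p ^ (level p (A + m) ((p : ℤ) ^ r₂ - (p : ℤ) ^ A * u * a) - m) else 0 := by
  set c : ℤ := (p : ℤ) ^ r₂ - (p : ℤ) ^ A * u * a with hc
  set w := level p (A + m) c with hw
  have hwL : w ≤ A + m := level_le _ _ _
  have hwc : (p : ℤ) ^ w ∣ c := pow_level_dvd _ _ _
  have hmw : m ≤ w := by
    rw [hw, le_level_iff (by omega)]
    refine dvd_sub (pow_dvd_pow _ hm) ?_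
    rw [mul_assoc]
    exact (pow_dvd_pow _ hmA).mul_right _
  have hcases : w = A + m ∨ ∃ c', ¬ (p : ℤ) ∣ c' ∧ c = (p : ℤ) ^ w * c' := by
    rcases hwL.eq_or_lt with h | h
    · exact Or.inl h
    · right
      obtain ⟨c', hc'⟩ := hwc
      refine ⟨c', ?_, hc'⟩
      rintro ⟨d, rfl⟩
      have : w + 1 ≤ w := by
        conv_rhs => rw [hw]
        rw [le_level_iff (by omega), hc']
        exact ⟨d, by ring⟩
      omega
  -- Write `p^r₁ + p^A u x = p^r₂ b`. The second condition becomes `x ≡ ab` modulo `p^m`; multiplied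
  -- by `p^A u`, it reads `cb ≡ p^r₁` modulo `p^(A + m)`. This is solvable in `b` exactly when `w ≤
  -- r₁`.
  split_ifs with h
  · -- a solution
    obtain ⟨b, hb⟩ : ∃ b : ℤ, (p : ℤ) ^ (A + m) ∣ c * b - (p : ℤ) ^ r₁ := by
      rcases hcases with h1 | ⟨c', hc', e⟩
      · refine ⟨0, ?_⟩
        rw [mul_zero, zero_sub, dvd_neg]
        exact pow_dvd_pow _ (h1 ▸ h)
      · have h2 : (p : ℤ) ^ min w (A + m) ∣ -(p : ℤ) ^ r₁ :=
          (dvd_neg).mpr (pow_dvd_pow _ (by omega))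
        obtain ⟨b, hb⟩ := exists_dvd_add_mul hc' h2
        exact ⟨b, by rw [e]; convert hb using 1; ring⟩
    -- The modulus exceeds `p^(r₂ + m)` by the factor `p^A` that is lost when `p^A u` is cancelled
    -- in `s2`.
    obtain ⟨x₀, hx₀⟩ : ∃ x : ℤ, (p : ℤ) ^ (A + r₂ + m) ∣
        ((p : ℤ) ^ r₁ - (p : ℤ) ^ r₂ * b) + (p : ℤ) ^ A * u * x := by
      apply exists_dvd_add_mul hu
      rw [min_eq_left (by omega)]
      have h1 := (pow_dvd_pow (p : ℤ) (show A ≤ A + m by omega)).trans hb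
      have h2 : (p : ℤ) ^ A ∣ (p : ℤ) ^ A * u * a * b := by
        rw [mul_assoc, mul_assoc]; exact dvd_mul_right _ _
      have h3 := dvd_add h1 h2
      rw [← dvd_neg]
      exact h3.trans (Eq.dvd (by rw [hc]; ring))
    have s1 : (p : ℤ) ^ r₂ ∣ (p : ℤ) ^ r₁ + (p : ℤ) ^ A * u * x₀ := by
      have h1 := (pow_dvd_pow (p : ℤ) (show r₂ ≤ A + r₂ + m by omega)).trans hx₀
      have h2 := dvd_add h1 (dvd_mul_right ((p : ℤ) ^ r₂) b)
      exact h2.trans (Eq.dvd (by ring))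
    have s2 : (p : ℤ) ^ (r₂ + m) ∣ c * x₀ - (p : ℤ) ^ r₁ * a := by
      have h1 : (p : ℤ) ^ (A + r₂ + m) ∣ (p : ℤ) ^ A * u * (c * x₀ - (p : ℤ) ^ r₁ * a) := by
        have h2 := hx₀.mul_left c
        have h3 : (p : ℤ) ^ (A + r₂ + m) ∣ (p : ℤ) ^ r₂ * (c * b - (p : ℤ) ^ r₁) := by
          rw [show A + r₂ + m = r₂ + (A + m) by ring, pow_add _ r₂]
          exact mul_dvd_mul_left _ hb
        have h4 := dvd_add h2 h3
        exact h4.trans (Eq.dvd (by rw [hc]; ring))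
      rw [pow_dvd_mul_iff hu] at h1
      exact (pow_dvd_pow _ (by omega)).trans h1
    -- the translates of the solution
    have hwr : w - m ≤ r₂ := by
      by_contra hlt
      have h1 : (p : ℤ) ^ (r₂ + 1) ∣ c := (pow_dvd_pow _ (by omega)).trans hwc
      have h2 : (p : ℤ) ^ (r₂ + 1) ∣ (p : ℤ) ^ A * u * a := by
        rw [mul_assoc]
        exact (pow_dvd_pow _ (by omega)).mul_right _
      have h3 := dvd_add h1 h2
      rw [hc, sub_add_cancel, pow_dvd_pow_int_iff] at h3
      omega
    -- The difference `x - x₀` must be divisible by `p^(r₂ - A)`, and by `p^(r₂ + m - w)` when `c`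
    -- is exactly divisible by `p^w`. The latter is the stronger since `w ≤ A + m`, and for `w = A +
    -- m` the two exponents agree.
    have key : ∀ x : ℕ, ((p : ℤ) ^ r₂ ∣ (p : ℤ) ^ r₁ + (p : ℤ) ^ A * u * (x : ℤ) ∧
        (p : ℤ) ^ (r₂ + m) ∣ c * (x : ℤ) - (p : ℤ) ^ r₁ * a) ↔
        (p : ℤ) ^ (r₂ - (w - m)) ∣ (x : ℤ) - x₀ := by
      intro x
      have e1 : (p : ℤ) ^ r₁ + (p : ℤ) ^ A * u * (x : ℤ) =
        ((p : ℤ) ^ r₁ + (p : ℤ) ^ A * u * x₀) + (p : ℤ) ^ A * u * (x - x₀) := by ring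
      have e2 : c * (x : ℤ) - (p : ℤ) ^ r₁ * a =
        (c * x₀ - (p : ℤ) ^ r₁ * a) + c * (x - x₀) := by ring
      rw [e1, e2, dvd_add_right s1, dvd_add_right s2, pow_dvd_mul_iff hu]
      constructor
      · rintro ⟨h1, h2⟩
        rcases hcases with h3 | ⟨c', hc', e⟩
        · exact (pow_dvd_pow _ (by omega)).trans h1
        · rw [e, pow_dvd_mul_iff hc'] at h2
          exact (pow_dvd_pow _ (by omega)).trans h2
      · intro h1
        refine ⟨(pow_dvd_pow _ (by omega)).trans h1, ?_⟩
        have h2 := mul_dvd_mul hwc h1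
        rw [← pow_add] at h2
        exact (pow_dvd_pow _ (by omega)).trans h2
    simp only [key]
    rw [card_filter_dvd_sub (Nat.sub_le _ _)]
    congr 1
    omega
  · rw [Finset.card_eq_zero, Finset.filter_eq_empty_iff]
    rintro x - ⟨⟨b, hb⟩, h2⟩
    apply h
    have h3 : (p : ℤ) ^ (r₂ + m) ∣ (p : ℤ) ^ r₂ * ((x : ℤ) - a * b) := by
      exact h2.trans (Eq.dvd (by rw [hc]; linear_combination -a * hb))
    rw [pow_dvd_pow_mul_iff, Nat.add_sub_cancel_left] at h3
    have h4 : (p : ℤ) ^ (A + m) ∣ c * b - (p : ℤ) ^ r₁ := by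
      have h5 := mul_dvd_mul (dvd_mul_right ((p : ℤ) ^ A) u) h3
      rw [← pow_add] at h5
      exact h5.trans (Eq.dvd (by rw [hc]; linear_combination hb))
    have h5 := (pow_dvd_pow (p : ℤ) hwL).trans h4
    rw [dvd_sub_right (hwc.mul_right b), pow_dvd_pow_int_iff] at h5
    exact h5

variable {A D : ℕ} {α β : ℤ}

/-- For fixed first coordinate, the second solves a linear congruence with leading coefficient `β`,
which has `p ^ min A r₃` solutions or none. Its solvability condition is the second congruence of
`card_first_coordinates` with `m = min A r₃`, and the factor `p ^ m` cancels against the `p ^ (w -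
m)` found there. -/
theorem card_tops {u v : ℤ} (hu : ¬ (p : ℤ) ∣ u) (hv : ¬ (p : ℤ) ∣ v)
    (hα : α = (p : ℤ) ^ A * u) (hβ : β = (p : ℤ) ^ A * v) {r₁ r₂ r₃ a : ℕ}
    (ha : a ∈ slopes p α β r₂ r₃) :
    (tops p α β r₁ r₂ r₃ a).card =
      if level p (A + min A r₃) ((p : ℤ) ^ r₂ - α * a) ≤ r₁ then
        p ^ level p (A + min A r₃) ((p : ℤ) ^ r₂ - α * a) else 0 := by
  -- `p ^ A` divides `β - α`, so the slope condition modulo `p ^ min A r₃` only involves `p ^ r₂`.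
  have hmr : min A r₃ ≤ r₂ := by
    have h := (Finset.mem_filter.mp ha).2
    have h1 := (pow_dvd_pow (p : ℤ) (min_le_right A r₃)).trans h
    rw [dvd_add_left, pow_dvd_pow_int_iff] at h1
    · exact h1
    · refine Dvd.dvd.mul_left ?_ _
      refine (pow_dvd_pow (p : ℤ) (min_le_left A r₃)).trans ?_
      exact ⟨v - u, by rw [hα, hβ]; ring⟩
  have hmw : min A r₃ ≤ level p (A + min A r₃) ((p : ℤ) ^ r₂ - α * a) := by
    rw [le_level_iff (by omega), hα]
    refine dvd_sub (pow_dvd_pow _ hmr) ?_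
    rw [mul_assoc]
    exact (pow_dvd_pow _ (min_le_left _ _)).mul_right _
  have hfib : ∀ x : ℕ, ({y ∈ Finset.range (p ^ r₃) |
      (p : ℤ) ^ r₂ ∣ (p : ℤ) ^ r₁ + α * (x : ℤ) ∧
      (p : ℤ) ^ (r₂ + r₃) ∣ ((p : ℤ) ^ r₂ - α * a) * (x : ℤ) +
        β * (p : ℤ) ^ r₂ * ((y : ℕ) : ℤ) - (p : ℤ) ^ r₁ * a} : Finset ℕ).card =
      if (p : ℤ) ^ r₂ ∣ (p : ℤ) ^ r₁ + α * (x : ℤ) ∧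
        (p : ℤ) ^ (r₂ + min A r₃) ∣ ((p : ℤ) ^ r₂ - α * a) * (x : ℤ) - (p : ℤ) ^ r₁ * a
      then p ^ min A r₃ else 0 := by
    intro x
    by_cases h : (p : ℤ) ^ r₂ ∣ (p : ℤ) ^ r₁ + α * (x : ℤ)
    · obtain ⟨b, hb⟩ := h
      have e1 : ∀ y : ℕ, ((p : ℤ) ^ r₂ ∣ (p : ℤ) ^ r₁ + α * (x : ℤ) ∧
          (p : ℤ) ^ (r₂ + r₃) ∣ ((p : ℤ) ^ r₂ - α * a) * (x : ℤ) +
            β * (p : ℤ) ^ r₂ * ((y : ℕ) : ℤ) - (p : ℤ) ^ r₁ * a) ↔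
          (p : ℤ) ^ r₃ ∣ ((x : ℤ) - a * b) + (p : ℤ) ^ A * v * y := by
        intro y
        rw [and_iff_right ⟨b, hb⟩]
        have : ((p : ℤ) ^ r₂ - α * a) * (x : ℤ) +
            β * (p : ℤ) ^ r₂ * ((y : ℕ) : ℤ) - (p : ℤ) ^ r₁ * a =
            (p : ℤ) ^ r₂ * (((x : ℤ) - a * b) + (p : ℤ) ^ A * v * y) := by
          rw [hβ]
          linear_combination (-(a : ℤ)) * hb
        rw [this, pow_dvd_pow_mul_iff, Nat.add_sub_cancel_left]
      simp only [e1]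
      rw [card_linear_congruence hv]
      congr 1
      rw [and_iff_right ⟨b, hb⟩]
      have : ((p : ℤ) ^ r₂ - α * a) * (x : ℤ) - (p : ℤ) ^ r₁ * a =
          (p : ℤ) ^ r₂ * ((x : ℤ) - a * b) := by
        linear_combination (-(a : ℤ)) * hb
      rw [this, pow_dvd_pow_mul_iff, Nat.add_sub_cancel_left]
    · simp [h]
  have h1 : (tops p α β r₁ r₂ r₃ a).card = ∑ x ∈ Finset.range (p ^ r₂),
      if (p : ℤ) ^ r₂ ∣ (p : ℤ) ^ r₁ + α * (x : ℤ) ∧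
        (p : ℤ) ^ (r₂ + min A r₃) ∣ ((p : ℤ) ^ r₂ - α * a) * (x : ℤ) - (p : ℤ) ^ r₁ * a
      then p ^ min A r₃ else 0 := by
    rw [tops, Finset.card_filter, Finset.sum_product]
    refine Finset.sum_congr rfl fun x _ => ?_
    rw [← hfib, Finset.card_filter]
  rw [h1, ← Finset.sum_filter, Finset.sum_const, smul_eq_mul]
  subst hα
  rw [card_first_coordinates hu hmr (min_le_left _ _)]
  split_ifs
  · rw [← pow_add, Nat.sub_add_cancel hmw]
  · rw [zero_mul]

theorem E_eq_sum {u v : ℤ} (hu : ¬ (p : ℤ) ∣ u) (hv : ¬ (p : ℤ) ∣ v)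
    (hα : α = (p : ℤ) ^ A * u) (hβ : β = (p : ℤ) ^ A * v) (r₂ r₃ : ℕ) :
    E p α β r₂ r₃ = ∑ a ∈ slopes p α β r₂ r₃,
      (p : PowerSeries ℤ) ^ level p (A + min A r₃) ((p : ℤ) ^ r₂ - α * a) *
        tail (level p (A + min A r₃) ((p : ℤ) ^ r₂ - α * a)) := by
  ext r₁
  rw [E, PowerSeries.coeff_mk, count_eq_sum, map_sum, Nat.cast_sum]
  refine Finset.sum_congr rfl fun a ha => ?_
  rw [card_tops hu hv hα hβ ha]
  generalize level p (A + min A r₃) ((p : ℤ) ^ r₂ - α * a) = w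
  have e : (p : PowerSeries ℤ) ^ w = PowerSeries.C ((p : ℤ) ^ w) := by simp
  rw [e, PowerSeries.coeff_C_mul, tail, PowerSeries.coeff_mk]
  split_ifs <;> simp

end Counting

/-! ### Distribution of the levels on the six regions -/

section Regions

theorem level_eq_min {p L j : ℕ} {x : ℤ} (h1 : (p : ℤ) ^ j ∣ x) (h2 : ¬ (p : ℤ) ^ (j + 1) ∣ x) :
    level p L x = min j L := by
  refine level_eq (min_le_right _ _) fun k hk => ?_
  rw [le_min_iff, and_iff_left hk]
  refine ⟨fun h => ?_, fun h => (pow_dvd_pow _ h).trans h1⟩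
  by_contra hlt
  exact h2 ((pow_dvd_pow _ (by omega)).trans h)

theorem level_eq_top {p L : ℕ} {x : ℤ} (h : (p : ℤ) ^ L ∣ x) : level p L x = L :=
  level_eq le_rfl fun _ hk => ⟨fun _ => hk, fun _ => (pow_dvd_pow _ hk).trans h⟩

variable {p : ℕ} [hp : Fact p.Prime]

theorem cosets_succ (k : ℕ) : cosets p (k + 1) = (p : ℤ) ^ (k + 1) - (p : ℤ) ^ k := by
  rw [cosets, pow_succ, Nat.mul_div_cancel _ hp.out.pos]
  push_cast
  ring

/-- Splitting a sum over residues modulo `p ^ n` according to the `p`-adic distance to `x₀`. -/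
theorem sum_filter_dvd_sub {B : Type} [CommRing B] (x₀ : ℤ) {m l n : ℕ} (hml : m ≤ l)
    (hln : l ≤ n) (g h : ℕ → B)
    (hgh : ∀ x i : ℕ, m ≤ i → i < l → (p : ℤ) ^ i ∣ (x : ℤ) - x₀ →
      ¬ (p : ℤ) ^ (i + 1) ∣ (x : ℤ) - x₀ → g x = h i) :
    ∑ x ∈ Finset.range (p ^ n) with (p : ℤ) ^ m ∣ ((x : ℕ) : ℤ) - x₀, g x =
      ∑ i ∈ Finset.Ico m l, (cosets p (n - i) : B) * h i +
        ∑ x ∈ Finset.range (p ^ n) with (p : ℤ) ^ l ∣ ((x : ℕ) : ℤ) - x₀, g x := by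
  induction l, hml using Nat.le_induction with
  | base => simp
  | succ l hl ih =>
    rw [ih (by omega) fun x i h1 h2 => hgh x i h1 (by omega), Finset.sum_Ico_succ_top hl, add_assoc]
    congr 1
    rw [← Finset.sum_filter_add_sum_filter_not _ (fun x : ℕ => (p : ℤ) ^ (l + 1) ∣ (x : ℤ) - x₀),
      add_comm, Finset.filter_filter, Finset.filter_filter]
    have h1 : ∀ x : ℕ, ((p : ℤ) ^ l ∣ (x : ℤ) - x₀ ∧ (p : ℤ) ^ (l + 1) ∣ (x : ℤ) - x₀) ↔
        (p : ℤ) ^ (l + 1) ∣ (x : ℤ) - x₀ := fun x =>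
      and_iff_right_of_imp fun h => (pow_dvd_pow _ (Nat.le_succ l)).trans h
    simp only [h1]
    congr 1
    have hc := Finset.card_filter_add_card_filter_not
      (s := {x ∈ Finset.range (p ^ n) | (p : ℤ) ^ l ∣ ((x : ℕ) : ℤ) - x₀})
      (fun x : ℕ => (p : ℤ) ^ (l + 1) ∣ (x : ℤ) - x₀)
    rw [Finset.filter_filter, Finset.filter_filter, card_filter_dvd_sub (by omega)] at hc
    simp only [h1] at hc
    rw [card_filter_dvd_sub hln] at hc
    rw [Finset.sum_congr rfl (g := fun _ => h l), Finset.sum_const, nsmul_eq_mul]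
    · congr 1
      obtain ⟨j, rfl⟩ : ∃ j, n = l + 1 + j := Nat.exists_eq_add_of_le hln
      rw [show l + 1 + j - (l + 1) = j by omega] at hc
      rw [show l + 1 + j - l = j + 1 by omega] at hc ⊢
      rw [cosets_succ]
      have := congrArg (Nat.cast : ℕ → B) hc
      push_cast at this ⊢
      rw [← this]
      ring
    · intro x hx
      obtain ⟨-, h2, h3⟩ := Finset.mem_filter.mp hx
      exact hgh x l hl (by omega) h2 h3

variable {A D : ℕ} {α β u v z : ℤ}

/-- Here `p ^ r₂` vanishes modulo `p ^ r₃`, so the slope condition is homogeneous. The centre `0` is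
kept explicit to match the ring decomposition of `sum_filter_dvd_sub`. -/
theorem slopes_eq_of_le (hz : ¬ (p : ℤ) ∣ z) (hδ : β - α = (p : ℤ) ^ D * z) {r₂ r₃ : ℕ}
    (h : r₃ ≤ r₂) :
    slopes p α β r₂ r₃ = {a ∈ Finset.range (p ^ r₃) | (p : ℤ) ^ (r₃ - D) ∣ ((a : ℕ) : ℤ) - 0} := by
  rw [slopes]
  congr 1
  ext a
  rw [dvd_add_right (pow_dvd_pow _ h), hδ, mul_comm, pow_dvd_mul_iff hz, sub_zero]

theorem card_slopes (hz : ¬ (p : ℤ) ∣ z) (hδ : β - α = (p : ℤ) ^ D * z) {r₂ r₃ : ℕ}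
    (h2 : D ≤ r₂) (h3 : D ≤ r₃) : (slopes p α β r₂ r₃).card = p ^ D := by
  have := card_linear_congruence (A := D) (n := r₃) (e := (p : ℤ) ^ r₂) hz
  rw [min_eq_left h3, if_pos (pow_dvd_pow _ h2)] at this
  rw [← this, slopes]
  congr 2
  ext a
  rw [hδ, mul_comm (a : ℤ)]

/-- Modulo `p ^ (r₂ + 1)` the slope condition would force `p ^ r₂` to vanish. -/
theorem slopes_eq_empty (hδ : β - α = (p : ℤ) ^ D * z) {r₂ r₃ : ℕ}
    (h : r₂ < min D r₃) : slopes p α β r₂ r₃ = ∅ := by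
  rw [slopes, Finset.filter_eq_empty_iff]
  intro a _ ha
  have h1 := (pow_dvd_pow (p : ℤ) (show r₂ + 1 ≤ r₃ by omega)).trans ha
  rw [dvd_add_left, pow_dvd_pow_int_iff] at h1
  · omega
  · rw [hδ]
    exact ((pow_dvd_pow _ (by omega)).mul_right _).mul_left _

theorem E_eq_zero (hu : ¬ (p : ℤ) ∣ u) (hv : ¬ (p : ℤ) ∣ v)
    (hα : α = (p : ℤ) ^ A * u) (hβ : β = (p : ℤ) ^ A * v)
    (hδ : β - α = (p : ℤ) ^ D * z) {r₂ r₃ : ℕ} (h : r₂ < min D r₃) : E p α β r₂ r₃ = 0 := by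
  rw [E_eq_sum hu hv hα hβ, slopes_eq_empty hδ h, Finset.sum_empty]

theorem E_eq_of_level_eq (hu : ¬ (p : ℤ) ∣ u) (hv : ¬ (p : ℤ) ∣ v)
    (hα : α = (p : ℤ) ^ A * u) (hβ : β = (p : ℤ) ^ A * v) {r₂ r₃ w : ℕ}
    (h : ∀ a ∈ slopes p α β r₂ r₃, level p (A + min A r₃) ((p : ℤ) ^ r₂ - α * a) = w) :
    E p α β r₂ r₃ =
      ((slopes p α β r₂ r₃).card : PowerSeries ℤ) * ((p : PowerSeries ℤ) ^ w * tail w) := by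
  rw [E_eq_sum hu hv hα hβ, Finset.sum_congr rfl (g := fun _ => (p : PowerSeries ℤ) ^ w * tail w),
    Finset.sum_const, nsmul_eq_mul]
  intro a ha
  rw [h a ha]

theorem E_region_zero (hu : ¬ (p : ℤ) ∣ u) (hv : ¬ (p : ℤ) ∣ v) (hz : ¬ (p : ℤ) ∣ z)
    (hα : α = (p : ℤ) ^ A * u) (hβ : β = (p : ℤ) ^ A * v) (hδ : β - α = (p : ℤ) ^ D * z)
    {r₂ r₃ : ℕ} (h2 : D + A ≤ r₂) (h3 : D + A ≤ r₃) :
    E p α β r₂ r₃ = explicitE tail p A D r₂ r₃ 0 := by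
  rw [E_eq_of_level_eq hu hv hα hβ (w := 2 * A), card_slopes hz hδ (by omega) (by omega)]
  · simp only [explicitE]
    push_cast
    ring
  · intro a ha
    rw [min_eq_left (by omega), ← two_mul]
    apply level_eq_top
    have ha := (Finset.mem_filter.mp ha).2
    -- Both terms on the right are divisible by `p^(D + 2A)`; cancelling `β - α = p^D z` shows that
    -- the cap `2A` is attained.
    have e : (p : ℤ) ^ D * z * ((p : ℤ) ^ r₂ - α * a) =
        (p : ℤ) ^ A * (p : ℤ) ^ r₂ * v -
          (p : ℤ) ^ A * ((p : ℤ) ^ r₂ + a * (β - α)) * u := by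
      rw [← hδ]
      linear_combination (p : ℤ) ^ r₂ * hβ - ((p : ℤ) ^ r₂ + a * (β - α)) * hα
    have := pow_dvd_mul_iff (A := D) hz (D + 2 * A) ((p : ℤ) ^ r₂ - α * a)
    rw [Nat.add_sub_cancel_left] at this
    rw [← this, e, show D + 2 * A = A + (D + A) by ring, pow_add]
    exact dvd_sub ((mul_dvd_mul_left _ (pow_dvd_pow _ h2)).mul_right _)
      ((mul_dvd_mul_left _ ((pow_dvd_pow _ h3).trans ha)).mul_right _)

theorem E_region_one (hu : ¬ (p : ℤ) ∣ u) (hv : ¬ (p : ℤ) ∣ v) (hz : ¬ (p : ℤ) ∣ z)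
    (hα : α = (p : ℤ) ^ A * u) (hβ : β = (p : ℤ) ^ A * v) (hδ : β - α = (p : ℤ) ^ D * z)
    {r₂ r₃ : ℕ} (h3 : D ≤ r₃) (h2 : D ≤ r₂) (h : r₂ < min (D + A) r₃) :
    E p α β r₂ r₃ = explicitE tail p A D r₂ r₃ 1 := by
  rw [E_eq_of_level_eq hu hv hα hβ (w := r₂ - D + A), card_slopes hz hδ h2 h3]
  · simp only [explicitE]
    rw [show r₂ + A = D + (r₂ - D + A) by omega, pow_add]
    push_cast
    ring
  · intro a ha
    have ha := (Finset.mem_filter.mp ha).2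
    have e : (p : ℤ) ^ D * z * ((p : ℤ) ^ r₂ - α * a) =
        (p : ℤ) ^ A * v * (p : ℤ) ^ r₂ -
          (p : ℤ) ^ A * ((p : ℤ) ^ r₂ + a * (β - α)) * u := by
      rw [← hδ]
      linear_combination (p : ℤ) ^ r₂ * hβ - ((p : ℤ) ^ r₂ + a * (β - α)) * hα
    -- As `r₂ < r₃`, the term `βp^r₂`, of valuation exactly `A + r₂`, dominates the other one, which
    -- is divisible by `p^(A + r₃)`.
    have key : ∀ k, k ≤ A + r₃ → ((p : ℤ) ^ k ∣ (p : ℤ) ^ D * z * ((p : ℤ) ^ r₂ - α * a) ↔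
        k ≤ A + r₂) := by
      intro k hk
      have h4 : (p : ℤ) ^ k ∣ (p : ℤ) ^ A * ((p : ℤ) ^ r₂ + a * (β - α)) * u := by
        refine (pow_dvd_pow _ hk).trans ?_
        rw [pow_add]
        exact (mul_dvd_mul_left _ ha).mul_right _
      rw [e, dvd_sub_left h4, pow_dvd_mul_iff hv, pow_dvd_pow_int_iff]
      omega
    rw [level_eq_min (j := r₂ - D + A)]
    · omega
    · have := (key (A + r₂) (by omega)).mpr le_rfl
      rw [pow_dvd_mul_iff hz] at this
      rwa [show r₂ - D + A = A + r₂ - D by omega]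
    · intro h5
      have := (key (A + r₂ + 1) (by omega)).mp
      rw [pow_dvd_mul_iff hz, show A + r₂ + 1 - D = r₂ - D + A + 1 by omega] at this
      have := this h5
      omega

/-- Every residue modulo `p ^ r₃` is a slope because `r₃ ≤ D`, and `αa` is more divisible than `p ^
r₂` because `r₂ < A`. -/
theorem E_region_four (hu : ¬ (p : ℤ) ∣ u) (hv : ¬ (p : ℤ) ∣ v) (hz : ¬ (p : ℤ) ∣ z)
    (hα : α = (p : ℤ) ^ A * u) (hβ : β = (p : ℤ) ^ A * v) (hδ : β - α = (p : ℤ) ^ D * z)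
    (hAD : A ≤ D) {r₂ r₃ : ℕ} (h : r₃ ≤ r₂) (h2 : r₂ < A) :
    E p α β r₂ r₃ = explicitE tail p A D r₂ r₃ 4 := by
  rw [E_eq_of_level_eq hu hv hα hβ (w := r₂), slopes_eq_of_le hz hδ h,
    card_filter_dvd_sub (Nat.sub_le _ _), Nat.sub_eq_zero_of_le (by omega : r₃ ≤ D)]
  · simp only [explicitE]
    rw [pow_add]
    push_cast
    rw [Nat.sub_zero]
    ring
  · intro a _
    have h4 : (p : ℤ) ^ (r₂ + 1) ∣ α * a := by
      rw [hα, mul_assoc]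
      exact (pow_dvd_pow _ h2).mul_right _
    rw [level_eq_min (j := r₂)]
    · omega
    · exact dvd_sub dvd_rfl ((pow_dvd_pow _ (Nat.le_succ r₂)).trans h4)
    · rw [dvd_sub_left h4, pow_dvd_pow_int_iff]
      omega

/-- The level of `p ^ r₂ - α a` when `α a` has small valuation. -/
theorem level_of_valuation (hu : ¬ (p : ℤ) ∣ u) (hα : α = (p : ℤ) ^ A * u) {r₂ L i : ℕ} {a : ℤ}
    (hi : A + i < r₂) (h1 : (p : ℤ) ^ i ∣ a) (h2 : ¬ (p : ℤ) ^ (i + 1) ∣ a) :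
    level p L ((p : ℤ) ^ r₂ - α * a) = min (A + i) L := by
  apply level_eq_min
  · rw [dvd_sub_right (pow_dvd_pow _ hi.le), hα, pow_dvd_mul_iff hu, Nat.add_sub_cancel_left]
    exact h1
  · rw [dvd_sub_right (pow_dvd_pow _ hi), hα, pow_dvd_mul_iff hu, add_assoc,
      Nat.add_sub_cancel_left]
    exact h2

/-- Since `p ^ r₂` is divisible by `p ^ (2A)`, the level is governed by `αa`: it is `A + i` if `a`
has valuation `i < A`, and the cap `2A` on the remaining `p ^ (r₃ - A)` residues. -/
theorem E_region_two (hu : ¬ (p : ℤ) ∣ u) (hv : ¬ (p : ℤ) ∣ v) (hz : ¬ (p : ℤ) ∣ z)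
    (hα : α = (p : ℤ) ^ A * u) (hβ : β = (p : ℤ) ^ A * v) (hδ : β - α = (p : ℤ) ^ D * z)
    {r₂ r₃ : ℕ} (h : A ≤ r₃) (h3 : r₃ < D + A) (h2 : r₃ + A ≤ r₂) :
    E p α β r₂ r₃ = explicitE tail p A D r₂ r₃ 2 := by
  rw [E_eq_sum hu hv hα hβ, slopes_eq_of_le hz hδ (by omega),
    sum_filter_dvd_sub 0 (by omega : r₃ - D ≤ A) h _
      (fun i => (p : PowerSeries ℤ) ^ (A + i) * tail (A + i))]
  · simp only [explicitE]
    congr 1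
    · refine Finset.sum_congr rfl fun i _ => ?_
      ring
    · rw [Finset.sum_congr rfl (g := fun _ => (p : PowerSeries ℤ) ^ (2 * A) * tail (2 * A)),
        Finset.sum_const, nsmul_eq_mul, card_filter_dvd_sub h]
      · push_cast
        rw [← mul_assoc, ← pow_add]
        congr 2
        omega
      · intro a ha
        have ha := (Finset.mem_filter.mp ha).2
        rw [sub_zero] at ha
        rw [min_eq_left h, ← two_mul, level_eq_top]
        refine dvd_sub (pow_dvd_pow _ (by omega)) ?_
        rw [hα, pow_dvd_mul_iff hu]
        exact (pow_dvd_pow _ (by omega)).trans ha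
  · intro a i _ hi h4 h5
    rw [sub_zero] at h4 h5
    rw [level_of_valuation hu hα (by omega) h4 h5, min_eq_left (by omega)]

/-- The cap is now `A + r₃`, reached only by the zero residue; this is the term `i = r₃` of the
explicit sum, where `cosets p 0 = 1`. -/
theorem E_region_three (hu : ¬ (p : ℤ) ∣ u) (hv : ¬ (p : ℤ) ∣ v) (hz : ¬ (p : ℤ) ∣ z)
    (hα : α = (p : ℤ) ^ A * u) (hβ : β = (p : ℤ) ^ A * v) (hδ : β - α = (p : ℤ) ^ D * z)
    (hAD : A ≤ D) {r₂ r₃ : ℕ} (h3 : r₃ < A) (h2 : A + r₃ ≤ r₂) :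
    E p α β r₂ r₃ = explicitE tail p A D r₂ r₃ 3 := by
  rw [E_eq_sum hu hv hα hβ, slopes_eq_of_le hz hδ (by omega),
    sum_filter_dvd_sub 0 (by omega : r₃ - D ≤ r₃) le_rfl _
      (fun i => (p : PowerSeries ℤ) ^ (A + i) * tail (A + i))]
  · simp only [explicitE]
    rw [Finset.sum_range_succ, Nat.sub_eq_zero_of_le (by omega : r₃ ≤ D), ← Finset.range_eq_Ico]
    congr 1
    · refine Finset.sum_congr rfl fun i _ => ?_
      ring
    · rw [Finset.sum_congr rfl
        (g := fun _ => (p : PowerSeries ℤ) ^ (A + r₃) * tail (A + r₃)),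
        Finset.sum_const, nsmul_eq_mul, card_filter_dvd_sub le_rfl]
      · have : cosets p 0 = 1 := by simp [cosets, Nat.div_eq_of_lt hp.out.one_lt]
        rw [Nat.sub_self, this]
        simp
      · intro a ha
        have ha := (Finset.mem_filter.mp ha).2
        rw [sub_zero] at ha
        rw [min_eq_right h3.le, level_eq_top]
        refine dvd_sub (pow_dvd_pow _ h2) ?_
        rw [hα, pow_dvd_mul_iff hu, Nat.add_sub_cancel_left]
        exact ha
  · intro a i _ hi h4 h5
    rw [sub_zero] at h4 h5
    rw [level_of_valuation hu hα (by omega) h4 h5, min_eq_left (by omega)]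

theorem E_region_five (hu : ¬ (p : ℤ) ∣ u) (hv : ¬ (p : ℤ) ∣ v) (hz : ¬ (p : ℤ) ∣ z)
    (hα : α = (p : ℤ) ^ A * u) (hβ : β = (p : ℤ) ^ A * v) (hδ : β - α = (p : ℤ) ^ D * z)
    (hAD : A ≤ D) {r₂ r₃ : ℕ} (h : max A r₃ ≤ r₂) (h2 : r₂ < A + r₃) :
    E p α β r₂ r₃ = explicitE tail p A D r₂ r₃ 5 := by
  -- `x₀` solves `αx = p^r₂` modulo `p^(A + r₃)`, so up to the cap the level of `p^r₂ - αa` is `A`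
  -- plus the valuation of `a - x₀`.
  obtain ⟨x₀, hx₀⟩ : ∃ x₀ : ℤ, (p : ℤ) ^ (A + r₃) ∣ -(p : ℤ) ^ r₂ + (p : ℤ) ^ A * u * x₀ :=
    exists_dvd_add_mul hu (dvd_neg.mpr (pow_dvd_pow _ (by omega)))
  rw [← hα] at hx₀
  have hx₀' : (p : ℤ) ^ (r₂ - A) ∣ x₀ := by
    have h4 := (pow_dvd_pow (p : ℤ) h2.le).trans hx₀
    rwa [dvd_add_right (dvd_neg.mpr dvd_rfl), hα, pow_dvd_mul_iff hu] at h4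
  have hsplit : ∀ a : ℤ, (p : ℤ) ^ r₂ - α * a =
      -(-(p : ℤ) ^ r₂ + α * x₀) - α * (a - x₀) := fun a => by ring
  rw [E_eq_sum hu hv hα hβ, slopes_eq_of_le hz hδ (by omega),
    sum_filter_dvd_sub 0 (by omega : r₃ - D ≤ r₂ - A) (by omega) _
      (fun i => (p : PowerSeries ℤ) ^ min (A + i) (A + min A r₃) *
        tail (min (A + i) (A + min A r₃)))]
  -- Rings around `0` serve for valuations below `r₂ - A`. The remaining ball contains `x₀`, so it
  -- can be recentred there and cut into rings again.
  · have hcenter : ∀ a : ℕ, (p : ℤ) ^ (r₂ - A) ∣ (a : ℤ) - 0 ↔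
        (p : ℤ) ^ (r₂ - A) ∣ (a : ℤ) - x₀ := fun a => by
      rw [sub_zero, dvd_sub_left hx₀']
    simp only [hcenter]
    rw [sum_filter_dvd_sub x₀ (by omega : r₂ - A ≤ r₃) le_rfl _
      (fun i => (p : PowerSeries ℤ) ^ min (A + i) (A + min A r₃) *
        tail (min (A + i) (A + min A r₃)))]
    · simp only [explicitE]
      rw [show min (2 * A) (r₃ + A) = A + min A r₃ by omega, add_assoc]
      congr 1
      · refine Finset.sum_congr rfl fun i _ => ?_
        ring
      -- With `N + 1 = r₃ + A - r₂`, the ring `j = 0` has `p^(N+1) - p^N` residues; the explicit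
      -- formula distributes them as `p^(N+1) - 2p^N` in the sum over `j` and `p^N` in its last
      -- term. The index `j = N + 1` is the single residue of `x₀`, where the rounded quotient `1 /
      -- p` is `0`.
      · obtain ⟨N, hN⟩ : ∃ N, r₃ + A - r₂ = N + 1 := ⟨r₃ + A - r₂ - 1, by omega⟩
        rw [hN, Finset.sum_Ico_eq_sum_range, show r₃ - (r₂ - A) = N + 1 by omega,
          Finset.sum_range_succ', Finset.sum_range_succ _ (N + 1), Finset.sum_range_succ' _ N]
        rw [Finset.sum_congr rfl (g := fun _ => (p : PowerSeries ℤ) ^ (A + min A r₃) *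
          tail (A + min A r₃)) (s₁ := Finset.filter _ _), Finset.sum_const, nsmul_eq_mul,
          card_filter_dvd_sub le_rfl]
        · have hsum : ∀ j ∈ Finset.range N,
              (cosets p (r₃ - (r₂ - A + (j + 1))) : PowerSeries ℤ) *
                ((p : PowerSeries ℤ) ^ min (A + (r₂ - A + (j + 1))) (A + min A r₃) *
                  tail (min (A + (r₂ - A + (j + 1))) (A + min A r₃))) =
              (p : PowerSeries ℤ) ^ min (r₂ + (j + 1)) (A + min A r₃) *
                ((p : PowerSeries ℤ) ^ (N + 1 - (j + 1)) -
                  (if j + 1 = 0 then 2 else 1) *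
                    ((p ^ (N + 1 - (j + 1)) / p : ℕ) : PowerSeries ℤ)) *
                tail (min (r₂ + (j + 1)) (A + min A r₃)) := by
            intro j hj
            rw [Finset.mem_range] at hj
            rw [show A + (r₂ - A + (j + 1)) = r₂ + (j + 1) by omega,
              show r₃ - (r₂ - A + (j + 1)) = N + 1 - (j + 1) by omega,
              if_neg (by omega), cosets, Int.cast_sub, Int.cast_natCast, Int.cast_natCast,
              Nat.cast_pow]
            ring
          rw [Finset.sum_congr rfl hsum]
          have hlast : p ^ (N + 1 - (N + 1)) / p = 0 := by
            simp [Nat.div_eq_of_lt hp.out.one_lt]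
          have hfirst : p ^ (N + 1 - 0) / p = p ^ N := by
            rw [Nat.sub_zero, pow_succ, Nat.mul_div_cancel _ hp.out.pos]
          rw [hlast, hfirst, if_pos rfl, if_neg (by omega), show r₃ - (r₂ - A + 0) = N + 1 by omega,
            cosets_succ, show A + (r₂ - A + 0) = r₂ by omega, add_zero,
            show min (r₂ + (N + 1)) (A + min A r₃) = A + min A r₃ by omega]
          simp only [Nat.sub_self, Nat.sub_zero, Nat.add_sub_cancel]
          push_cast
          ring
        · intro a ha
          have ha := (Finset.mem_filter.mp ha).2
          rw [level_eq_top]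
          refine (pow_dvd_pow _ (show A + min A r₃ ≤ A + r₃ by omega)).trans ?_
          rw [hsplit]
          refine dvd_sub (dvd_neg.mpr hx₀) ?_
          rw [hα, pow_dvd_mul_iff hu, Nat.add_sub_cancel_left]
          exact ha
    · intro a i _ hi h4 h5
      rw [level_eq_min (j := A + i)]
      · rw [hsplit, dvd_sub_right (dvd_neg.mpr ((pow_dvd_pow _ (by omega)).trans hx₀)), hα,
          pow_dvd_mul_iff hu, Nat.add_sub_cancel_left]
        exact h4
      · rw [hsplit, dvd_sub_right (dvd_neg.mpr ((pow_dvd_pow _ (by omega)).trans hx₀)), hα,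
          pow_dvd_mul_iff hu, add_assoc, Nat.add_sub_cancel_left]
        exact h5
  · intro a i _ hi h4 h5
    rw [sub_zero] at h4 h5
    rw [level_of_valuation hu hα (by omega) h4 h5]

theorem E_eq_explicitE (hu : ¬ (p : ℤ) ∣ u) (hv : ¬ (p : ℤ) ∣ v) (hz : ¬ (p : ℤ) ∣ z)
    (hα : α = (p : ℤ) ^ A * u) (hβ : β = (p : ℤ) ^ A * v) (hδ : β - α = (p : ℤ) ^ D * z)
    (hAD : A ≤ D) (i : Fin 6) (q : ℕ × ℕ) (hq : q ∈ region A D i) :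
    E p α β q.2 q.1 = explicitE tail p A D q.2 q.1 i := by
  fin_cases i
  · exact E_region_zero hu hv hz hα hβ hδ hq.1 hq.2
  · exact E_region_one hu hv hz hα hβ hδ hq.1 hq.2.1 hq.2.2
  · exact E_region_two hu hv hz hα hβ hδ hq.1 hq.2.1 hq.2.2
  · exact E_region_three hu hv hz hα hβ hδ hAD hq.1 hq.2
  · exact E_region_four hu hv hz hα hβ hδ hAD hq.1 hq.2
  · exact E_region_five hu hv hz hα hβ hδ hAD hq.2.1 hq.2.2

end Regions

/-! ### Summation over each region as a formal power series -/

section RegionSums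

open PowerSeries.WithPiTopology

/-- The geometric series `∑ X ^ n`. -/
noncomputable def geom : PowerSeries ℤ := PowerSeries.mk 1

theorem one_sub_X_mul_geom : (1 - PowerSeries.X) * geom = 1 := by
  rw [mul_comm, geom]
  exact PowerSeries.mk_one_mul_one_sub_eq_one ℤ

theorem tail_eq (l : ℕ) : tail l = PowerSeries.X ^ l * geom := by
  ext n
  rw [PowerSeries.coeff_X_pow_mul', tail, geom]
  simp

/-- The explicit formula is linear in the symbol `T`, so the common factor `1 / (1 - X)` of all
tails can be taken out. -/
theorem explicitE_mul_right {B : Type} [CommRing B] (t : ℕ → B) (c : B) (p A D r₂ r₃ : ℕ)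
    (i : Fin 6) :
    explicitE (fun l => t l * c) p A D r₂ r₃ i = explicitE t p A D r₂ r₃ i * c := by
  fin_cases i <;> simp only [explicitE, add_mul, Finset.sum_mul, mul_assoc]

theorem explicitE_map {B C : Type} [CommRing B] [CommRing C] (φ : B →+* C) (t : ℕ → B)
    (p A D r₂ r₃ : ℕ) (i : Fin 6) :
    φ (explicitE t p A D r₂ r₃ i) = explicitE (fun l => φ (t l)) p A D r₂ r₃ i := by
  fin_cases i <;>
    simp only [explicitE, map_add, map_sum, map_mul, map_pow, map_natCast, map_intCast, map_sub,
      apply_ite φ, map_one, map_ofNat]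

theorem explicitE_tail (p A D r₂ r₃ : ℕ) (i : Fin 6) :
    explicitE tail p A D r₂ r₃ i =
      explicitE (fun l => (PowerSeries.X : PowerSeries ℤ) ^ l) p A D r₂ r₃ i * geom := by
  rw [← explicitE_mul_right]
  congr 1
  ext1 l
  exact tail_eq l

theorem hasSum_X_pow : HasSum (fun k : ℕ => (PowerSeries.X : PowerSeries ℤ) ^ k) geom := by
  rw [hasSum_iff_hasSum_coeff]
  intro d
  simp only [PowerSeries.coeff_X_pow, geom, PowerSeries.coeff_mk, Pi.one_apply]
  exact hasSum_ite_eq' d 1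

theorem hasSum_X_pow_add :
    HasSum (fun k : ℕ × ℕ => (PowerSeries.X : PowerSeries ℤ) ^ (k.1 + k.2)) (geom * geom) := by
  rw [hasSum_iff_hasSum_coeff]
  intro d
  have e : PowerSeries.coeff d (geom * geom) = ∑ k ∈ Finset.HasAntidiagonal.antidiagonal d,
      PowerSeries.coeff d ((PowerSeries.X : PowerSeries ℤ) ^ (k.1 + k.2)) := by
    rw [PowerSeries.coeff_mul]
    refine Finset.sum_congr rfl fun k hk => ?_
    rw [Finset.HasAntidiagonal.mem_antidiagonal.mp hk]
    simp [geom]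
  rw [e]
  refine hasSum_sum_of_ne_finset_zero fun k hk => ?_
  rw [PowerSeries.coeff_X_pow, if_neg]
  rw [Finset.HasAntidiagonal.mem_antidiagonal] at hk
  exact fun h => hk h.symm

theorem hasSum_of_forall_eq {B γ : Type} [AddCommMonoid B] [TopologicalSpace B] {f g : γ → B}
    {a : B} (h : ∀ k, f k = g k) (hg : HasSum g a) : HasSum f a := by
  rwa [funext h]

theorem hasSum_of_param {B γ δ : Type} [AddCommMonoid B] [TopologicalSpace B]
    {f : γ → B} {s : Set γ} {e : δ → γ} {a : B}
    (he : Function.Injective e) (hs : ∀ q, q ∈ s ↔ ∃ k, e k = q)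
    (h : HasSum (fun k => f (e k)) a) : HasSum (fun q : s => f q) a := by
  obtain rfl : s = Set.range e := Set.ext hs
  exact he.hasSum_range_iff.mpr h

/-- This serves the regions that are finite unions of disjoint half-lines, each contributing a
geometric series. -/
theorem hasSum_of_lines {B γ : Type} [AddCommMonoid B] [TopologicalSpace B] [ContinuousAdd B]
    {f : γ → B} {s : Set γ} (I : Finset ℕ) (e : ℕ → ℕ → γ) (a : ℕ → B)
    (he : ∀ i j k l, e i k = e j l → i = j ∧ k = l)
    (hs : ∀ q, q ∈ s ↔ ∃ i ∈ I, ∃ k, e i k = q)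
    (h : ∀ i ∈ I, HasSum (fun k => f (e i k)) (a i)) :
    HasSum (fun q : s => f q) (∑ i ∈ I, a i) := by
  obtain rfl : s = ⋃ i ∈ I, Set.range (e i) := by
    ext q
    simp [hs]
  refine hasSum_sum_disjoint (f := f) I ?_ ?_
  · intro i _ j _ hij
    refine Set.disjoint_left.mpr ?_
    rintro _ ⟨k, rfl⟩ ⟨l, hl⟩
    exact hij (he _ _ _ _ hl).1.symm
  · intro i hi
    refine Function.Injective.hasSum_range_iff (g := e i) (fun k l hkl => ?_) |>.mpr (h i hi)
    exact (he _ _ _ _ hkl).2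

theorem hasSum_of_finset {B γ : Type} [AddCommMonoid B] [TopologicalSpace B] {f : γ → B}
    {s : Set γ} (I : Finset γ) (hs : ∀ q, q ∈ s ↔ q ∈ I) :
    HasSum (fun q : s => f q) (∑ q ∈ I, f q) := by
  obtain rfl : s = I := Set.ext hs
  exact I.hasSum f

/-- The summand of the region sums without the factor `1 / (1 - X)`. -/
noncomputable def summand (p A D : ℕ) (i : Fin 6) (q : ℕ × ℕ) : PowerSeries ℤ :=
  (PowerSeries.X : PowerSeries ℤ) ^ (q.2 + q.1) *
    explicitE (fun l => (PowerSeries.X : PowerSeries ℤ) ^ l) p A D q.2 q.1 i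

theorem hasSum_line {f : ℕ → PowerSeries ℤ} {b : PowerSeries ℤ}
    (h : ∀ k, f k = b * PowerSeries.X ^ k) : HasSum f (b * geom) :=
  hasSum_of_forall_eq h (hasSum_X_pow.mul_left b)

theorem coe_natCast (p : ℕ) : ((p : Polynomial ℤ) : PowerSeries ℤ) = (p : PowerSeries ℤ) :=
  map_natCast Polynomial.coeToPowerSeries.ringHom p

theorem coe_one_sub_X :
    ((1 - Polynomial.X : Polynomial ℤ) : PowerSeries ℤ) = 1 - PowerSeries.X := by
  simp

theorem coe_C_intCast (c : ℤ) :
    ((Polynomial.C c : Polynomial ℤ) : PowerSeries ℤ) = (c : PowerSeries ℤ) := by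
  rw [Polynomial.coe_C]
  simp

theorem coe_sum {ι : Type} (s : Finset ι) (f : ι → Polynomial ℤ) :
    ((∑ i ∈ s, f i : Polynomial ℤ) : PowerSeries ℤ) = ∑ i ∈ s, (f i : PowerSeries ℤ) :=
  map_sum Polynomial.coeToPowerSeries.ringHom f s

/-- Only `(1 - X)²` appears for a single region, because `summand` omits the factor `1 / (1 - X)`
produced by the sum over `r₁`. Here both factors come from the quadrant. -/
theorem hasSum_region_zero (p A D : ℕ) :
    ∃ S : PowerSeries ℤ, HasSum (fun q : region A D 0 => summand p A D 0 q) S ∧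
      (1 - PowerSeries.X) ^ 2 * S = (numer p A D 0 : PowerSeries ℤ) := by
  refine ⟨(p : PowerSeries ℤ) ^ (2 * A + D) * PowerSeries.X ^ (2 * (2 * A + D)) *
    (geom * geom), ?_, ?_⟩
  · refine hasSum_of_param (e := fun k : ℕ × ℕ => (D + A + k.1, D + A + k.2)) ?_ ?_ ?_
    · rintro ⟨a, b⟩ ⟨c, d⟩ h
      simp only [Prod.mk.injEq] at h ⊢
      omega
    · rintro ⟨a, b⟩
      simp only [region, Set.mem_ofPred_eq, Prod.exists, Prod.mk.injEq]
      constructor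
      · rintro ⟨h1, h2⟩
        exact ⟨a - (D + A), b - (D + A), by omega, by omega⟩
      · rintro ⟨c, d, h1, h2⟩
        omega
    · refine hasSum_of_forall_eq (fun k => ?_) (hasSum_X_pow_add.mul_left _)
      simp only [summand, explicitE]
      ring
  · simp only [numer, Polynomial.coe_mul, Polynomial.coe_pow, Polynomial.coe_X, coe_natCast]
    linear_combination (p : PowerSeries ℤ) ^ (2 * A + D) * PowerSeries.X ^ (2 * (2 * A + D)) *
      ((1 - PowerSeries.X) * geom + 1) * one_sub_X_mul_geom

theorem hasSum_region_one (p A D : ℕ) :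
    ∃ S : PowerSeries ℤ, HasSum (fun q : region A D 1 => summand p A D 1 q) S ∧
      (1 - PowerSeries.X) ^ 2 * S = (numer p A D 1 : PowerSeries ℤ) := by
  refine ⟨∑ r₂ ∈ Finset.Ico D (D + A), (p : PowerSeries ℤ) ^ (r₂ + A) *
    PowerSeries.X ^ (3 * r₂ + 1 + A - D) * geom, ?_, ?_⟩
  · refine hasSum_of_lines _ (fun r₂ k => (r₂ + 1 + k, r₂)) _ ?_ ?_ ?_
    · intro i j k l h
      simp only [Prod.mk.injEq] at h
      omega
    · rintro ⟨a, b⟩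
      simp only [region, Set.mem_ofPred_eq, Prod.mk.injEq, Finset.mem_Ico]
      constructor
      · rintro ⟨h1, h2, h3⟩
        exact ⟨b, by omega, a - b - 1, by omega, rfl⟩
      · rintro ⟨i, hi, k, h1, h2⟩
        omega
    · intro i hi
      rw [Finset.mem_Ico] at hi
      refine hasSum_line fun k => ?_
      simp only [summand, explicitE]
      -- The half-line starts at `r₃ = r₂ + 1`, which contributes `2r₂ + 1`; the tail contributes
      -- `r₂ - D + A`.
      rw [show 3 * i + 1 + A - D = (i - D + A) + (2 * i + 1) by omega]
      ring
  · simp only [numer, Polynomial.coe_mul, coe_one_sub_X, coe_sum, coe_natCast,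
      Polynomial.coe_pow, Polynomial.coe_X]
    rw [← Finset.sum_mul]
    linear_combination (1 - PowerSeries.X) * (∑ r₂ ∈ Finset.Ico D (D + A),
      (p : PowerSeries ℤ) ^ (r₂ + A) * PowerSeries.X ^ (3 * r₂ + 1 + A - D)) * one_sub_X_mul_geom

theorem hasSum_region_two (p A D : ℕ) :
    ∃ S : PowerSeries ℤ, HasSum (fun q : region A D 2 => summand p A D 2 q) S ∧
      (1 - PowerSeries.X) ^ 2 * S = (numer p A D 2 : PowerSeries ℤ) := by
  -- The explicit value does not depend on `r₂` in this region, so it may be taken at the starting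
  -- point `r₂ = r₃ + A` of the half-line.
  refine ⟨∑ r₃ ∈ Finset.Ico A (D + A), PowerSeries.X ^ (2 * r₃ + A) *
    explicitE (fun l => (PowerSeries.X : PowerSeries ℤ) ^ l) p A D (r₃ + A) r₃ 2 * geom, ?_, ?_⟩
  · refine hasSum_of_lines _ (fun r₃ k => (r₃, r₃ + A + k)) _ ?_ ?_ ?_
    · intro i j k l h
      simp only [Prod.mk.injEq] at h
      omega
    · rintro ⟨a, b⟩
      simp only [region, Set.mem_ofPred_eq, Prod.mk.injEq, Finset.mem_Ico]
      constructor
      · rintro ⟨h1, h2, h3⟩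
        exact ⟨a, by omega, b - a - A, by omega, by omega⟩
      · rintro ⟨i, hi, k, h1, h2⟩
        omega
    · intro i hi
      refine hasSum_line fun k => ?_
      simp only [summand, explicitE]
      ring
  · simp only [numer, Polynomial.coe_mul, coe_one_sub_X, coe_sum, coe_natCast,
      Polynomial.coe_pow, Polynomial.coe_X, Polynomial.coe_add, coe_C_intCast, explicitE]
    rw [← Finset.sum_mul, pow_two, mul_assoc, mul_comm _ geom, ← mul_assoc (1 - PowerSeries.X) geom,
      one_sub_X_mul_geom, one_mul]

theorem hasSum_region_three (p A D : ℕ) :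
    ∃ S : PowerSeries ℤ, HasSum (fun q : region A D 3 => summand p A D 3 q) S ∧
      (1 - PowerSeries.X) ^ 2 * S = (numer p A D 3 : PowerSeries ℤ) := by
  refine ⟨∑ r₃ ∈ Finset.range A, PowerSeries.X ^ (2 * r₃ + A) *
    explicitE (fun l => (PowerSeries.X : PowerSeries ℤ) ^ l) p A D (r₃ + A) r₃ 3 * geom, ?_, ?_⟩
  · refine hasSum_of_lines _ (fun r₃ k => (r₃, r₃ + A + k)) _ ?_ ?_ ?_
    · intro i j k l h
      simp only [Prod.mk.injEq] at h
      omega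
    · rintro ⟨a, b⟩
      simp only [region, Set.mem_ofPred_eq, Prod.mk.injEq, Finset.mem_range]
      constructor
      · rintro ⟨h1, h2⟩
        exact ⟨a, by omega, b - a - A, by omega, by omega⟩
      · rintro ⟨i, hi, k, h1, h2⟩
        omega
    · intro i hi
      refine hasSum_line fun k => ?_
      simp only [summand, explicitE]
      ring
  · simp only [numer, Polynomial.coe_mul, coe_one_sub_X, coe_sum, coe_natCast,
      Polynomial.coe_pow, Polynomial.coe_X, coe_C_intCast, explicitE]
    rw [← Finset.sum_mul, pow_two, mul_assoc, mul_comm _ geom, ← mul_assoc (1 - PowerSeries.X) geom,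
      one_sub_X_mul_geom, one_mul]

theorem hasSum_region_four (p A D : ℕ) :
    ∃ S : PowerSeries ℤ, HasSum (fun q : region A D 4 => summand p A D 4 q) S ∧
      (1 - PowerSeries.X) ^ 2 * S = (numer p A D 4 : PowerSeries ℤ) := by
  refine ⟨_, hasSum_of_finset {q ∈ Finset.range A ×ˢ Finset.range A | q.1 ≤ q.2} ?_, ?_⟩
  · rintro ⟨a, b⟩
    simp only [region, Set.mem_ofPred_eq, Finset.mem_filter, Finset.mem_product, Finset.mem_range]
    omega
  · rw [Finset.sum_finset_product_right _ (Finset.range A) (fun r₂ => Finset.range (r₂ + 1))]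
    · simp only [numer, Polynomial.coe_mul, coe_one_sub_X, coe_sum, coe_natCast,
        Polynomial.coe_pow, Polynomial.coe_X, summand, explicitE]
      congr 1
      refine Finset.sum_congr rfl fun r₂ _ => Finset.sum_congr rfl fun r₃ _ => ?_
      ring
    · rintro ⟨a, b⟩
      simp only [Finset.mem_filter, Finset.mem_product, Finset.mem_range]
      omega

theorem hasSum_region_five (p A D : ℕ) :
    ∃ S : PowerSeries ℤ, HasSum (fun q : region A D 5 => summand p A D 5 q) S ∧
      (1 - PowerSeries.X) ^ 2 * S = (numer p A D 5 : PowerSeries ℤ) := by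
  refine ⟨_, hasSum_of_finset {q ∈ Finset.range (D + A) ×ˢ Finset.range (A + (D + A)) |
    max A q.1 ≤ q.2 ∧ q.2 < A + q.1} ?_, ?_⟩
  · rintro ⟨a, b⟩
    simp only [region, Set.mem_ofPred_eq, Finset.mem_filter, Finset.mem_product, Finset.mem_range]
    omega
  · rw [Finset.sum_finset_product _ (Finset.range (D + A))
      (fun r₃ => Finset.Ico (max A r₃) (A + r₃))]
    · have h := fun r₂ r₃ => explicitE_map Polynomial.coeToPowerSeries.ringHom
        (fun l => (Polynomial.X : Polynomial ℤ) ^ l) p A D r₂ r₃ 5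
      simp only [Polynomial.coeToPowerSeries.ringHom_apply, Polynomial.coe_pow,
        Polynomial.coe_X] at h
      simp only [numer, Polynomial.coe_mul, coe_one_sub_X, coe_sum,
        Polynomial.coe_pow, Polynomial.coe_X, summand, h]
    · rintro ⟨a, b⟩
      simp only [Finset.mem_filter, Finset.mem_product, Finset.mem_range, Finset.mem_Ico]
      omega

/-- Each region contributes `N_i / (1 - X) ^ 3`. -/
theorem hasSum_region (p A D : ℕ) (i : Fin 6) :
    ∃ S : PowerSeries ℤ,
      HasSum (fun q : region A D i => (PowerSeries.X : PowerSeries ℤ) ^ (q.1.2 + q.1.1) *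
        explicitE tail p A D q.1.2 q.1.1 i) S ∧
      (1 - PowerSeries.X) ^ 3 * S = (numer p A D i : PowerSeries ℤ) := by
  have key : ∃ S : PowerSeries ℤ, HasSum (fun q : region A D i => summand p A D i q) S ∧
      (1 - PowerSeries.X) ^ 2 * S = (numer p A D i : PowerSeries ℤ) := by
    fin_cases i
    · exact hasSum_region_zero p A D
    · exact hasSum_region_one p A D
    · exact hasSum_region_two p A D
    · exact hasSum_region_three p A D
    · exact hasSum_region_four p A D
    · exact hasSum_region_five p A D
  obtain ⟨S, h1, h2⟩ := key
  refine ⟨S * geom, hasSum_of_forall_eq (fun q => ?_) (h1.mul_right geom), ?_⟩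
  · rw [explicitE_tail, summand, mul_assoc]
  · rw [← h2]
    linear_combination (1 - PowerSeries.X) ^ 2 * S * one_sub_X_mul_geom

end RegionSums

/-! ### Decomposition of the formal zeta series -/

section ZetaSeries

open PowerSeries.WithPiTopology

variable (p : ℕ) [hp : Fact p.Prime] (α β : ℤ)

theorem coeff_zetaSeries (n : ℕ) :
    PowerSeries.coeff n (zetaSeries p α β) =
      ∑ t ∈ triples n, (count p α β t.1 t.2.1 t.2.2 : ℤ) := by
  obtain ⟨s, hs, hc⟩ := exists_finset_ideals p α β n
  rw [zetaSeries, PowerSeries.coeff_mk, ← Nat.cast_sum, ← hc, Nat.card_congr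
    (Equiv.subtypeEquivRight fun I => (hs I).symm)]
  simp

theorem coeff_X_pow_mul_E (n k r₂ r₃ : ℕ) :
    PowerSeries.coeff n ((PowerSeries.X : PowerSeries ℤ) ^ k * E p α β r₂ r₃) =
      if k ≤ n then (count p α β (n - k) r₂ r₃ : ℤ) else 0 := by
  rw [PowerSeries.coeff_X_pow_mul', E, PowerSeries.coeff_mk]

/-- For a given power `X ^ n`, only the finitely many pairs with `r₂ + r₃ ≤ n` contribute, each
through `r₁ = n - r₂ - r₃`. -/
theorem hasSum_zetaSeries :
    HasSum (fun q : ℕ × ℕ => (PowerSeries.X : PowerSeries ℤ) ^ (q.2 + q.1) * E p α β q.2 q.1)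
      (zetaSeries p α β) := by
  rw [hasSum_iff_hasSum_coeff]
  intro n
  rw [coeff_zetaSeries]
  have e : ∑ t ∈ triples n, (count p α β t.1 t.2.1 t.2.2 : ℤ) =
      ∑ q ∈ {q ∈ Finset.range (n + 1) ×ˢ Finset.range (n + 1) | q.2 + q.1 ≤ n},
        PowerSeries.coeff n
          ((PowerSeries.X : PowerSeries ℤ) ^ (q.2 + q.1) * E p α β q.2 q.1) := by
    refine Finset.sum_nbij' (fun t => (t.2.2, t.2.1)) (fun q => (n - (q.2 + q.1), q.2, q.1))
      ?_ ?_ ?_ ?_ ?_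
    · intro t ht
      rw [mem_triples] at ht
      simp only [Finset.mem_filter, Finset.mem_product, Finset.mem_range]
      omega
    · intro q hq
      simp only [Finset.mem_filter, Finset.mem_product, Finset.mem_range] at hq
      rw [mem_triples]
      simp only
      omega
    · rintro ⟨a, b, c⟩ ht
      rw [mem_triples] at ht
      simp only [Prod.mk.injEq, and_true] at ht ⊢
      omega
    · intro q _
      rfl
    · rintro ⟨a, b, c⟩ ht
      rw [mem_triples] at ht
      simp only at ht
      rw [coeff_X_pow_mul_E, if_pos (by simp only; omega)]
      simp only
      rw [show n - (b + c) = a by omega]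
  rw [e]
  refine hasSum_sum_of_ne_finset_zero fun q hq => ?_
  rw [coeff_X_pow_mul_E, if_neg]
  intro h
  apply hq
  simp only [Finset.mem_filter, Finset.mem_product, Finset.mem_range]
  omega

variable {p α β} {A D : ℕ}

theorem region_disjoint {i j : Fin 6} (hij : i ≠ j) :
    Disjoint (region A D i) (region A D j) := by
  rw [Set.disjoint_left]
  rintro ⟨a, b⟩ hi hj
  fin_cases i <;> fin_cases j <;> first
    | exact hij rfl
    | (simp [region] at hi hj; omega)

theorem mem_region_of_le {q : ℕ × ℕ} (h : min D q.1 ≤ q.2) :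
    ∃ i, q ∈ region A D i := by
  by_contra hcon
  push Not at hcon
  have h0 := hcon 0
  have h1 := hcon 1
  have h2 := hcon 2
  have h3 := hcon 3
  have h4 := hcon 4
  have h5 := hcon 5
  simp only [region, Set.mem_ofPred_eq] at h0 h1 h2 h3 h4 h5
  omega

/-- The regions are disjoint and cover all pairs with `min D r₃ ≤ r₂`; the rest contribute zero. -/
theorem zetaSeries_eq_sum
    (hE : ∀ r₂ r₃ : ℕ, r₂ < min D r₃ → E p α β r₂ r₃ = 0) {S : Fin 6 → PowerSeries ℤ}
    (hS : ∀ i, HasSum (fun q : region A D i =>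
      (PowerSeries.X : PowerSeries ℤ) ^ (q.1.2 + q.1.1) * E p α β q.1.2 q.1.1) (S i)) :
    zetaSeries p α β = ∑ i, S i := by
  refine (hasSum_zetaSeries p α β).unique ?_
  have h := hasSum_sum_disjoint (f := fun q : ℕ × ℕ =>
    (PowerSeries.X : PowerSeries ℤ) ^ (q.2 + q.1) * E p α β q.2 q.1) Finset.univ
    (t := region A D) (fun i _ j _ hij => region_disjoint hij) (fun i _ => hS i)
  rwa [hasSum_subtype_iff_of_support_subset] at h
  intro q hq
  rw [Function.mem_support] at hq
  have hq2 : min D q.1 ≤ q.2 := by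
    by_contra hlt
    rw [hE _ _ (not_le.mp hlt), mul_zero] at hq
    exact hq rfl
  obtain ⟨i, hi⟩ := mem_region_of_le hq2
  exact Set.mem_biUnion (Finset.mem_coe.mpr (Finset.mem_univ i)) hi

/-- The coefficients of a region sum, as finite sums over the triples of given weight. -/
theorem exists_finset_coeff_region {s : Set (ℕ × ℕ)} {F : PowerSeries ℤ}
    (hF : HasSum (fun q : s =>
      (PowerSeries.X : PowerSeries ℤ) ^ (q.1.2 + q.1.1) * E p α β q.1.2 q.1.1) F) (n : ℕ) :
    ∃ T : Finset (s × ℕ), (∀ t, t ∈ T ↔ t.2 + t.1.1.2 + t.1.1.1 = n) ∧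
      PowerSeries.coeff n F = ∑ t ∈ T, (count p α β t.2 t.1.1.2 t.1.1.1 : ℤ) := by
  classical
  have hfin : {q : s | q.1.2 + q.1.1 ≤ n}.Finite := by
    refine Set.Finite.of_finite_image (f := Subtype.val) ?_ Subtype.val_injective.injOn
    refine ((Finset.range (n + 1)) ×ˢ (Finset.range (n + 1))).finite_toSet.subset ?_
    rintro _ ⟨q, hq, rfl⟩
    simp only [Set.mem_ofPred_eq] at hq
    simp only [Finset.coe_product, Finset.coe_range, Set.mem_prod, Set.mem_Iio]
    omega
  have hinj : Function.Injective fun q : s => (q, n - (q.1.2 + q.1.1)) :=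
    fun q r h => (Prod.mk.inj h).1
  refine ⟨hfin.toFinset.image fun q => (q, n - (q.1.2 + q.1.1)), ?_, ?_⟩
  · rintro ⟨q, r⟩
    simp only [Finset.mem_image, Set.Finite.mem_toFinset, Set.mem_ofPred_eq, Prod.mk.injEq]
    constructor
    · rintro ⟨q, hq, rfl, rfl⟩
      omega
    · intro h
      exact ⟨q, by omega, rfl, by omega⟩
  · rw [Finset.sum_image hinj.injOn]
    refine ((hasSum_iff_hasSum_coeff ℤ).mp hF n).unique ?_
    have e : ∑ q ∈ hfin.toFinset, (count p α β (n - (q.1.2 + q.1.1)) q.1.2 q.1.1 : ℤ) =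
        ∑ q ∈ hfin.toFinset, PowerSeries.coeff n
          ((PowerSeries.X : PowerSeries ℤ) ^ (q.1.2 + q.1.1) * E p α β q.1.2 q.1.1) := by
      refine Finset.sum_congr rfl fun q hq => ?_
      rw [Set.Finite.mem_toFinset, Set.mem_ofPred_eq] at hq
      rw [coeff_X_pow_mul_E, if_pos hq]
    rw [e]
    refine hasSum_sum_of_ne_finset_zero fun q hq => ?_
    rw [Set.Finite.mem_toFinset, Set.mem_ofPred_eq] at hq
    rw [coeff_X_pow_mul_E, if_neg hq]

end ZetaSeries

/-! ### From formal series to absolutely convergent ones -/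

section Evaluation

/-- `G` is `H` times the geometric series, so its evaluation is the Cauchy product of two absolutely
convergent series. Three applications remove `(1 - X)³`. -/
theorem hasSum_eval_step {G H : PowerSeries ℤ} (h : (1 - PowerSeries.X) * G = H) {z y : ℂ}
    (hz : ‖z‖ < 1)
    (hs : Summable fun n => ‖((PowerSeries.coeff n H : ℤ) : ℂ) * z ^ n‖)
    (hy : HasSum (fun n => ((PowerSeries.coeff n H : ℤ) : ℂ) * z ^ n) y) :
    (Summable fun n => ‖((PowerSeries.coeff n G : ℤ) : ℂ) * z ^ n‖) ∧
      HasSum (fun n => ((PowerSeries.coeff n G : ℤ) : ℂ) * z ^ n) (y / (1 - z)) := by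
  have hG : G = H * geom := by
    rw [← h]
    linear_combination -G * one_sub_X_mul_geom
  have hgeo : Summable fun n => ‖z ^ n‖ := summable_norm_geometric_of_norm_lt_one hz
  have hterm : (fun n => ((PowerSeries.coeff n G : ℤ) : ℂ) * z ^ n) = fun n =>
      ∑ kl ∈ Finset.HasAntidiagonal.antidiagonal n,
        ((PowerSeries.coeff kl.1 H : ℤ) : ℂ) * z ^ kl.1 * z ^ kl.2 := by
    funext n
    rw [hG, PowerSeries.coeff_mul, Int.cast_sum, Finset.sum_mul]
    refine Finset.sum_congr rfl fun kl hkl => ?_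
    rw [← Finset.HasAntidiagonal.mem_antidiagonal.mp hkl, pow_add]
    simp [geom, mul_assoc]
  have hterm' := fun n => congrFun hterm n
  have hsum : Summable fun n => ‖((PowerSeries.coeff n G : ℤ) : ℂ) * z ^ n‖ := by
    simp only [hterm']
    exact summable_norm_sum_mul_antidiagonal_of_summable_norm
      (f := fun n => ((PowerSeries.coeff n H : ℤ) : ℂ) * z ^ n) (g := fun n => z ^ n) hs hgeo
  refine ⟨hsum, ?_⟩
  have ht := tsum_mul_tsum_eq_tsum_sum_antidiagonal_of_summable_norm
    (f := fun n => ((PowerSeries.coeff n H : ℤ) : ℂ) * z ^ n) (g := fun n => z ^ n) hs hgeo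
  rw [hy.tsum_eq, tsum_geometric_of_norm_lt_one hz, ← hterm, ← div_eq_mul_inv] at ht
  rw [ht]
  exact hsum.of_norm.hasSum

theorem hasSum_polynomial (N : Polynomial ℤ) (z : ℂ) :
    (Summable fun n => ‖((PowerSeries.coeff n (N : PowerSeries ℤ) : ℤ) : ℂ) * z ^ n‖) ∧
      HasSum (fun n => ((PowerSeries.coeff n (N : PowerSeries ℤ) : ℤ) : ℂ) * z ^ n)
        (Polynomial.aeval z N) := by
  have h0 : ∀ n ∉ Finset.range (N.natDegree + 1),
      ((PowerSeries.coeff n (N : PowerSeries ℤ) : ℤ) : ℂ) * z ^ n = 0 := by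
    intro n hn
    rw [Finset.mem_range, not_lt] at hn
    rw [Polynomial.coeff_coe, Polynomial.coeff_eq_zero_of_natDegree_lt (by omega)]
    simp
  constructor
  · exact summable_of_ne_finset_zero (s := Finset.range (N.natDegree + 1))
      fun n hn => by rw [h0 n hn, norm_zero]
  · rw [Polynomial.aeval_eq_sum_range]
    have e : ∀ n ∈ Finset.range (N.natDegree + 1), N.coeff n • z ^ n =
        ((PowerSeries.coeff n (N : PowerSeries ℤ) : ℤ) : ℂ) * z ^ n := fun n _ => by
      rw [Polynomial.coeff_coe, zsmul_eq_mul]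
    rw [Finset.sum_congr rfl e]
    exact hasSum_sum_of_ne_finset_zero h0

theorem hasSum_eval_coeff {F : PowerSeries ℤ} {N : Polynomial ℤ}
    (h : (1 - PowerSeries.X) ^ 3 * F = (N : PowerSeries ℤ)) {z : ℂ} (hz : ‖z‖ < 1) :
    (Summable fun n => ‖((PowerSeries.coeff n F : ℤ) : ℂ) * z ^ n‖) ∧
      HasSum (fun n => ((PowerSeries.coeff n F : ℤ) : ℂ) * z ^ n)
        (Polynomial.aeval z N / (1 - z) ^ 3) := by
  have h0 := hasSum_polynomial N z
  have h1 := hasSum_eval_step (G := (1 - PowerSeries.X) ^ 2 * F) (by rw [← h]; ring) hz h0.1 h0.2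
  have h2 := hasSum_eval_step (G := (1 - PowerSeries.X) * F) (by ring) hz h1.1 h1.2
  have h3 := hasSum_eval_step (G := F) rfl hz h2.1 h2.2
  have e : Polynomial.aeval z N / (1 - z) ^ 3 =
      Polynomial.aeval z N / (1 - z) / (1 - z) / (1 - z) := by
    rw [div_div, div_div]
    ring_nf
  rw [e]
  exact h3

/-- Evaluation at `z` of a weighted family whose generating series is `N / (1 - X) ^ 3`. -/
theorem hasSum_eval {ι : Type} (w m : ι → ℕ) {F : PowerSeries ℤ} {N : Polynomial ℤ}
    (hF : ∀ n, ∃ s : Finset ι, (∀ i, i ∈ s ↔ w i = n) ∧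
      PowerSeries.coeff n F = ∑ i ∈ s, (m i : ℤ))
    (h : (1 - PowerSeries.X) ^ 3 * F = (N : PowerSeries ℤ)) {z : ℂ} (hz : ‖z‖ < 1) :
    HasSum (fun i => (m i : ℂ) * z ^ w i) (Polynomial.aeval z N / (1 - z) ^ 3) := by
  classical
  obtain ⟨hs, hsum⟩ := hasSum_eval_coeff h hz
  choose s hs1 hs2 using hF
  -- The multiplicities are natural numbers, so there is no cancellation within a given weight:
  -- absolute convergence of the coefficient series yields that of the whole family.
  have hfib : ∀ n, ∑ i ∈ s n, ‖(m i : ℂ) * z ^ w i‖ =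
      ‖((PowerSeries.coeff n F : ℤ) : ℂ) * z ^ n‖ := by
    intro n
    have e1 : ∀ i ∈ s n, ‖(m i : ℂ) * z ^ w i‖ = (m i : ℝ) * ‖z‖ ^ n := by
      intro i hi
      rw [(hs1 n i).mp hi, norm_mul, norm_pow, Complex.norm_natCast]
    rw [Finset.sum_congr rfl e1, ← Finset.sum_mul, hs2, norm_mul, norm_pow, ← Nat.cast_sum,
      ← Nat.cast_sum, Int.cast_natCast, Complex.norm_natCast]
  have hsummable : Summable fun i => ‖(m i : ℂ) * z ^ w i‖ := by
    refine summable_of_sum_le (c := ∑' n, ‖((PowerSeries.coeff n F : ℤ) : ℂ) * z ^ n‖)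
      (fun i => norm_nonneg _) fun u => ?_
    have hsub : u ⊆ (Finset.range (u.sup w + 1)).biUnion s := by
      intro i hi
      rw [Finset.mem_biUnion]
      exact ⟨w i, Finset.mem_range.mpr (Nat.lt_succ_of_le (Finset.le_sup hi)), (hs1 _ i).mpr rfl⟩
    refine (Finset.sum_le_sum_of_subset_of_nonneg hsub fun i _ _ => norm_nonneg _).trans ?_
    rw [Finset.sum_biUnion]
    · rw [Finset.sum_congr rfl fun n _ => hfib n]
      exact hs.sum_le_tsum _ fun n _ => norm_nonneg _
    · intro a _ b _ hab
      refine Finset.disjoint_left.mpr fun i hi hj => hab ?_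
      rw [← (hs1 a i).mp hi, ← (hs1 b i).mp hj]
  have hsm : Summable fun i => (m i : ℂ) * z ^ w i := hsummable.of_norm
  have h3 := hsm.hasSum.tsum_fiberwise w
  have e2 : ∀ n, ∑' i : w ⁻¹' {n}, (m i : ℂ) * z ^ w i =
      ((PowerSeries.coeff n F : ℤ) : ℂ) * z ^ n := by
    intro n
    have e3 : w ⁻¹' {n} = (s n : Set ι) := by
      ext i
      simp [hs1]
    rw [e3, Finset.tsum_subtype' (s n) (fun i => (m i : ℂ) * z ^ w i), hs2, Int.cast_sum,
      Finset.sum_mul]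
    refine Finset.sum_congr rfl fun i hi => ?_
    rw [(hs1 n i).mp hi, Int.cast_natCast]
  simp only [e2] at h3
  rw [← h3.unique hsum]
  exact hsm.hasSum

end Evaluation

/-! ### The zeta function of a complex variable -/

section Complex

theorem natCast_cpow_mul (p : ℕ) (s : ℂ) (n : ℕ) : (p : ℂ) ^ (-s * (n : ℂ)) = ((p : ℂ) ^ (-s)) ^ n := by
  rw [Complex.cpow_mul_nat]

theorem natCast_pow_cpow (p : ℕ) (s : ℂ) (n : ℕ) :
    ((p ^ n : ℕ) : ℂ) ^ (-s) = ((p : ℂ) ^ (-s)) ^ n := by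
  rw [← natCast_cpow_mul, mul_comm, Nat.cast_pow, ← Complex.natCast_cpow_natCast_mul]

variable {p : ℕ} [hp : Fact p.Prime] {α β : ℤ}

theorem norm_cpow_neg_lt_one {s : ℂ} (hs : 0 < s.re) : ‖(p : ℂ) ^ (-s)‖ < 1 := by
  rw [Complex.norm_natCast_cpow_of_pos hp.out.pos, Complex.neg_re]
  exact Real.rpow_lt_one_of_one_lt_of_neg (by exact_mod_cast hp.out.one_lt) (by linarith)

/-- Each ideal is counted with multiplicity one and weighted by the exponent of its index; the
fibres of the weight are the finite sets of ideals of given index. -/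
theorem hasSum_zeta {N : Polynomial ℤ}
    (h : (1 - PowerSeries.X) ^ 3 * zetaSeries p α β = (N : PowerSeries ℤ)) {s : ℂ}
    (hs : 0 < s.re) :
    HasSum (fun I : {I : Ideal (R p α β) // IsFull I} => (idx I.1 : ℂ) ^ (-s))
      (Polynomial.aeval ((p : ℂ) ^ (-s)) N / (1 - (p : ℂ) ^ (-s)) ^ 3) := by
  classical
  choose w hw using fun I : {I : Ideal (R p α β) // IsFull I} => exists_idx_eq I.2
  have := hasSum_eval w (fun _ => 1) (F := zetaSeries p α β) (fun n => ?_) h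
    (norm_cpow_neg_lt_one (p := p) hs)
  · refine hasSum_of_forall_eq (fun I => ?_) this
    rw [hw, natCast_pow_cpow]
    simp
  · obtain ⟨T, hT, hc⟩ := exists_finset_ideals p α β n
    refine ⟨T.subtype IsFull, fun I => ?_, ?_⟩
    · rw [Finset.mem_subtype, hT, hw, and_iff_right I.2]
      exact (Nat.pow_right_injective hp.out.two_le).eq_iff
    · rw [coeff_zetaSeries, ← Nat.cast_sum, ← hc, ← Nat.cast_sum, Finset.sum_const, smul_eq_mul,
        mul_one, Finset.card_subtype, Finset.filter_true_of_mem fun I hI => ((hT I).mp hI).1]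

theorem hasSum_region_eval {A D : ℕ} {i : Fin 6} {F : PowerSeries ℤ} {N : Polynomial ℤ}
    (hF : HasSum (fun q : region A D i =>
      (PowerSeries.X : PowerSeries ℤ) ^ (q.1.2 + q.1.1) * E p α β q.1.2 q.1.1) F)
    (h : (1 - PowerSeries.X) ^ 3 * F = (N : PowerSeries ℤ)) {s : ℂ} (hs : 0 < s.re) :
    HasSum (fun t : region A D i × ℕ => (count p α β t.2 t.1.1.2 t.1.1.1 : ℂ) *
      (p : ℂ) ^ (-s * ((t.2 + t.1.1.2 + t.1.1.1 : ℕ) : ℂ)))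
      (Polynomial.aeval ((p : ℂ) ^ (-s)) N / (1 - (p : ℂ) ^ (-s)) ^ 3) := by
  refine hasSum_of_forall_eq (fun t => ?_) (hasSum_eval
    (fun t : region A D i × ℕ => t.2 + t.1.1.2 + t.1.1.1)
    (fun t => count p α β t.2 t.1.1.2 t.1.1.1) (exists_finset_coeff_region hF) h
    (norm_cpow_neg_lt_one hs))
  rw [natCast_cpow_mul]

theorem exists_eq_pow_mul {a : ℤ} (ha : a ≠ 0) {n : ℕ} (h : padicValInt p a = n) :
    ∃ u : ℤ, ¬ (p : ℤ) ∣ u ∧ a = (p : ℤ) ^ n * u := by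
  obtain ⟨u, hu⟩ := (padicValInt_dvd_iff n a).mpr (Or.inr h.ge)
  refine ⟨u, ?_, hu⟩
  rintro ⟨v, rfl⟩
  have : (p : ℤ) ^ (n + 1) ∣ a := ⟨v, by rw [hu]; ring⟩
  rcases (padicValInt_dvd_iff (n + 1) a).mp this with h0 | h0
  · exact ha h0
  · omega

end Complex

end IdealZeta

/-! ### The main theorem -/

theorem theorem3p7 (p : ℕ) [Fact p.Prime] (α β : ℤ) (hα : α ≠ 0) (hβ : β ≠ 0) (hαβ : α ≠ β)
    (A D : ℕ) (hA : padicValInt p α = A) (hB : padicValInt p β = A)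
    (hD : padicValInt p (β - α) = D) (hAD : A ≤ D) :
    -- the formal Dirichlet series is well defined
    (∀ I : Ideal (IdealZeta.R p α β), IdealZeta.IsFull I → ∃ n : ℕ, IdealZeta.idx I = p ^ n) ∧
    (∀ n : ℕ, {I : Ideal (IdealZeta.R p α β) |
      IdealZeta.IsFull I ∧ IdealZeta.idx I = p ^ n}.Finite) ∧
    -- the decomposition over the six regions, as formal power series in `X = p^{-s}`
    (∀ i : Fin 6, Summable fun q : IdealZeta.region A D i =>
      (PowerSeries.X : PowerSeries ℤ) ^ (q.1.2 + q.1.1) * IdealZeta.E p α β q.1.2 q.1.1) ∧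
    IdealZeta.zetaSeries p α β = ∑ i : Fin 6, ∑' q : IdealZeta.region A D i,
      (PowerSeries.X : PowerSeries ℤ) ^ (q.1.2 + q.1.1) * IdealZeta.E p α β q.1.2 q.1.1 ∧
    -- the explicit values of `E(r₂, r₃)`
    (∀ i : Fin 6, ∀ q ∈ IdealZeta.region A D i,
      IdealZeta.E p α β q.2 q.1 = IdealZeta.explicitE IdealZeta.tail p A D q.2 q.1 i) ∧
    (∀ r₂ r₃ : ℕ, r₂ < min D r₃ → IdealZeta.E p α β r₂ r₃ = 0) ∧
    -- the resulting rational function of `X = p^{-s}`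
    (∀ i : Fin 6, (1 - PowerSeries.X : PowerSeries ℤ) ^ 3 * (∑' q : IdealZeta.region A D i,
      (PowerSeries.X : PowerSeries ℤ) ^ (q.1.2 + q.1.1) * IdealZeta.E p α β q.1.2 q.1.1) =
        (IdealZeta.numer p A D i : PowerSeries ℤ)) ∧
    (1 - PowerSeries.X : PowerSeries ℤ) ^ 3 * IdealZeta.zetaSeries p α β =
      ((∑ i : Fin 6, IdealZeta.numer p A D i : Polynomial ℤ) : PowerSeries ℤ) ∧
    -- the same as functions of a complex variable `s`
    (∀ s : ℂ, 0 < s.re →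
      (Summable fun I : {I : Ideal (IdealZeta.R p α β) // IdealZeta.IsFull I} =>
        (IdealZeta.idx I.1 : ℂ) ^ (-s)) ∧
      (∀ i : Fin 6, Summable fun t : IdealZeta.region A D i × ℕ =>
        (IdealZeta.count p α β t.2 t.1.1.2 t.1.1.1 : ℂ) *
          (p : ℂ) ^ (-s * ((t.2 + t.1.1.2 + t.1.1.1 : ℕ) : ℂ))) ∧
      IdealZeta.zeta p α β s = ∑ i : Fin 6, ∑' q : IdealZeta.region A D i, ∑' r₁ : ℕ,
        (IdealZeta.count p α β r₁ q.1.2 q.1.1 : ℂ) *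
          (p : ℂ) ^ (-s * ((r₁ + q.1.2 + q.1.1 : ℕ) : ℂ)) ∧
      IdealZeta.zeta p α β s =
        (∑ i : Fin 6, Polynomial.aeval ((p : ℂ) ^ (-s)) (IdealZeta.numer p A D i)) /
          (1 - (p : ℂ) ^ (-s)) ^ 3) := by
  open IdealZeta in
  obtain ⟨u, hu, hαu⟩ := exists_eq_pow_mul hα hA
  obtain ⟨v, hv, hβv⟩ := exists_eq_pow_mul hβ hB
  obtain ⟨z, hz, hδ⟩ := exists_eq_pow_mul (sub_ne_zero.mpr hαβ.symm) hD
  have hexpl := E_eq_explicitE hu hv hz hαu hβv hδ hAD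
  have hzero : ∀ r₂ r₃ : ℕ, r₂ < min D r₃ → E p α β r₂ r₃ = 0 :=
    fun _ _ h => E_eq_zero hu hv hαu hβv hδ h
  choose F hF hN using hasSum_region p A D
  have hFE : ∀ i, HasSum (fun q : region A D i =>
      (PowerSeries.X : PowerSeries ℤ) ^ (q.1.2 + q.1.1) * E p α β q.1.2 q.1.1) (F i) :=
    fun i => hasSum_of_forall_eq (fun q => by rw [hexpl i q.1 q.2]) (hF i)
  have hzeta : zetaSeries p α β = ∑ i, F i := zetaSeries_eq_sum hzero hFE
  have hnum : (1 - PowerSeries.X : PowerSeries ℤ) ^ 3 * zetaSeries p α β =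
      ((∑ i : Fin 6, numer p A D i : Polynomial ℤ) : PowerSeries ℤ) := by
    rw [hzeta, Finset.mul_sum, coe_sum]
    exact Finset.sum_congr rfl fun i _ => hN i
  refine ⟨fun I hI => exists_idx_eq hI, fun n => ?_, fun i => (hFE i).summable, ?_, hexpl, hzero,
    fun i => ?_, hnum, fun s hs => ?_⟩
  · obtain ⟨T, hT, -⟩ := exists_finset_ideals p α β n
    exact T.finite_toSet.subset fun I hI => (hT I).mpr hI
  · rw [hzeta]
    exact Finset.sum_congr rfl fun i _ => (hFE i).tsum_eq.symm
  · rw [(hFE i).tsum_eq, hN]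
  · have h1 := hasSum_zeta hnum hs
    have h2 := fun i => hasSum_region_eval (hFE i) (hN i) hs
    have h3 : zeta p α β s = _ := h1.tsum_eq
    refine ⟨h1.summable, fun i => (h2 i).summable, ?_, ?_⟩
    · rw [h3, map_sum, Finset.sum_div]
      refine Finset.sum_congr rfl fun i _ => ?_
      rw [← (h2 i).tsum_eq, (h2 i).summable.tsum_prod]
    · rw [h3, map_sum]
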